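/- **Setting.** Let $f,g:\mathbb R^p\times\mathbb R^q\to\mathbb R$ ($q\ge 1$) be continuously differentiable with $\nabla_y g$ continuously differentiable, $y^*(x)=\arg\min_y g(x,y)$ and $\Phi(x)=f(x,y^*(x))$. Assume that there are constants $L_x,L_{xy},L_y,\widetilde L_{xy},\widetilde L_y,\rho_{xy},\rho_{yy}\ge 0$ such that $\nabla_x f$ is $L_x$-Lipschitz in $x$ and $L_{xy}$-Lipschitz in $y$; $\nabla_y f$ is $L_{xy}$-Lipschitz in $x$ and $L_y$-Lipschitz in $y$; $\nabla_y g$ is $\widetilde L_{xy}$-Lipschitz in $x$ and $\widetilde L_y$-Lipschitz in $y$; $\nabla_x\nabla_y g$ and $\nabla_y^2 g$ are $\rho_{xy}$- and $\rho_{yy}$-Lipschitz in $(x,y)$. Assume that $g(x,\cdot)$ is $\mu_y$-strongly convex for every $x$, that $\Phi$ is $\mu_x$-strongly convex ($\mu_x,\mu_y>0$), that its minimizer $x^*$ satisfies $\|x^*\|=B$ for some $B>0$, and that $\|\nabla_y f(x,y)\|\le U$ for all $(x,y)$. Put $\kappa_y=\widetilde L_y/\mu_y$ and $$L_\Phi=L_x+\frac{2L_{xy}\widetilde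 L_{xy}}{\mu_y}+\Big(\frac{U\rho_{xy}}{\mu_y}+\frac{U\widetilde L_{xy}\rho_{yy}}{\mu_y^2}\Big)\Big(1+\frac{\widetilde L_{xy}}{\mu_y}\Big)+\frac{\widetilde L_{xy}^2L_y}{\mu_y^2}.$$ **Algorithm AccBiO-BG.** Start from $x_0=z_0=0$ and $y_0^0=0$. For $k=0,1,2,\dots$: set $\widetilde x_k=\eta x_k+(1-\eta)z_k$ and, for $k>0$, $y_k^0=y_{k-1}^N$. With $s_k^0=y_k^0$, run for $t=1,\dots,N$ $$y_k^t=s_k^{t-1}-\tfrac1{\widetilde L_y}\nabla_y g(\widetilde x_k,s_k^{t-1}),\qquad s_k^t=\tfrac{2\sqrt{\kappa_y}}{\sqrt{\kappa_y}+1}y_k^t-\tfrac{\sqrt{\kappa_y}-1}{\sqrt{\kappa_y}+1}y_k^{t-1}.$$ Compute $v_k^M$ by the heavy-ball recursion $v_k^{t+1}=v_k^t-\lambda\nabla Q(v_k^t)+\theta(v_k^t-v_k^{t-1})$, $v_k^0=v_k^1=0$, for $Q(v)=\frac12v^T\nabla_y^2g(\widetilde x_k,y_k^N)v-v^T\nabla_yf(\widetilde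 x_k,y_k^N)$. Put $G_k=\nabla_xf(\widetilde x_k,y_k^N)-\nabla_x\nabla_yg(\widetilde x_k,y_k^N)v_k^M$, $x_{k+1}=\tau\widetilde x_k+(1-\tau)x_k-\beta G_k$, $z_{k+1}=\widetilde x_k-\alpha G_k$. The parameters are $$\eta=\frac{\sqrt{\alpha\mu_x}}{\sqrt{\alpha\mu_x}+2},\quad \tau=\frac{\sqrt{\alpha\mu_x}}2,\quad \beta=\sqrt{\frac{\alpha}{\mu_x}},\quad \lambda=\frac4{(\sqrt{\widetilde L_y}+\sqrt{\mu_y})^2},\quad \theta=\max\{(1-\sqrt{\lambda\mu_y})^2,(1-\sqrt{\lambda\widetilde L_y})^2\},$$ and a stepsize $\alpha$ with $\frac{c}{L_\Phi}\le\alpha\le\frac1{2L_\Phi}$, where $c>0$ is a fixed constant (for instance $c=\frac12$, $\alpha=\frac1{2L_\Phi}$). The complexity of a run that outputs $z_K$ is $\mathcal C=t\,(n_J+n_H)+n_G$, where $n_J,n_H,n_G$ are the numbers of Jacobian-vector products, Hessian-vector products and gradient evaluations made in its $K$ outer iterations and $t>0$ is a universal constant. **Theorem.** $\Phi$ is differentiable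 with $L_\Phi$-Lipschitz gradient. Let $D>0$ be an arbitrary constant. There are polynomials $P_1,P_2$ with coefficients depending only on $L_x,L_{xy},L_y,\widetilde L_{xy},\rho_{xy},\rho_{yy},t,c,D$, and a constant $C>0$ depending only on these quantities and on $U$, such that whenever $\mu_y\le D$ and $0<\varepsilon\le D$, the numbers $N,M,K$ can be chosen so that AccBiO-BG reaches $\Phi(z_K)-\Phi(x^*)\le\varepsilon$ with complexity $$\mathcal C\le C\sqrt{\frac{\widetilde L_y}{\mu_x\mu_y^4}}\;\log\frac{P_1\big(\mu_x^{\pm1},\mu_y^{\pm1},\widetilde L_y,U,\Delta,r\big)}{\varepsilon}\;\log\frac{P_2\big(\mu_x^{\pm1},\mu_y^{\pm1},\widetilde L_y,U\big)}{\varepsilon},$$ where $\Delta\ge\Phi(0)-\Phi(x^*)$ and $r\ge\|y^*(0)\|$ are any upper bounds, and the values of $P_1,P_2$ exceed $\varepsilon$. The choice is uniform over the problem class: $N,M$ depend only on $\widetilde L_y,\mu_x,\mu_y,U,\varepsilon,\alpha$ and the constants above, and $K$ only on these and on $\Delta,r$ (in particular not on $p$, $q$, $f$, $g$ otherwise). 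-/

import Mathlib

noncomputable section

namespace Bilevel

/-- `ℝⁿ` with the Euclidean norm. -/
abbrev E (n : ℕ) : Type := EuclideanSpace ℝ (Fin n)

variable {p q : ℕ}

/-- The partial gradient `∇ₓ f(x, y) ∈ ℝᵖ`. -/
def gradX (f : E p → E q → ℝ) (x : E p) (y : E q) : E p :=
  gradient (fun x' => f x' y) x

/-- The partial gradient `∇_y f(x, y) ∈ ℝ^q`. -/
def gradY (f : E p → E q → ℝ) (x : E p) (y : E q) : E q :=
  gradient (f x) y

/-- The Hessian `∇²_y g(x, y) ∈ ℝ^{q × q}`, as a linear map. -/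
def hessY (g : E p → E q → ℝ) (x : E p) (y : E q) : E q →L[ℝ] E q :=
  fderiv ℝ (gradY g x) y

/-- The mixed derivative `∇ₓ∇_y g(x, y) ∈ ℝ^{p × q}`, as a linear map `ℝ^q → ℝᵖ`: its `(i, j)` entry
is `∂²g / ∂xᵢ∂yⱼ`, i.e. it is the transpose of the derivative of `x ↦ ∇_y g(x, y)`. -/
def jacXY (g : E p → E q → ℝ) (x : E p) (y : E q) : E q →L[ℝ] E p :=
  ContinuousLinearMap.adjoint (fderiv ℝ (fun x' => gradY g x' y) x)

/-- The lower-level solution `y*(x) = argmin_y g(x, y)` (a minimizer whenever there is one; under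
strong convexity of `g(x, ·)` it is the unique one). -/
def lowerSol (g : E p → E q → ℝ) (x : E p) : E q :=
  Classical.epsilon fun y => IsMinOn (g x) Set.univ y

/-- The bilevel objective `Φ(x) = f(x, y*(x))`. -/
def objective (f g : E p → E q → ℝ) (x : E p) : ℝ :=
  f x (lowerSol g x)

/-- The strongly-convex–strongly-convex class of bilevel problems. The constants `Lx, Lxy, Ly` are
the smoothness constants of `f`; `Lgxy, Lgy` (written `L̃_{xy}, L̃_y` in the text) are those of `g`;
`ρxy, ρyy` are the Lipschitz constants of `∇ₓ∇_y g` and `∇²_y g` with respect to the Euclidean norm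
of `(x, y)`. -/
structure IsSCSC (Lx Lxy Ly Lgxy Lgy ρxy ρyy μx μy : ℝ) (f g : E p → E q → ℝ) : Prop where
  f_contDiff : ContDiff ℝ 1 fun w : E p × E q => f w.1 w.2
  g_contDiff : ContDiff ℝ 1 fun w : E p × E q => g w.1 w.2
  gradY_g_contDiff : ContDiff ℝ 1 fun w : E p × E q => gradY g w.1 w.2
  gradX_f_lip_x : ∀ x₁ x₂ y, ‖gradX f x₁ y - gradX f x₂ y‖ ≤ Lx * ‖x₁ - x₂‖
  gradX_f_lip_y : ∀ x y₁ y₂, ‖gradX f x y₁ - gradX f x y₂‖ ≤ Lxy * ‖y₁ - y₂‖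
  gradY_f_lip_x : ∀ x₁ x₂ y, ‖gradY f x₁ y - gradY f x₂ y‖ ≤ Lxy * ‖x₁ - x₂‖
  gradY_f_lip_y : ∀ x y₁ y₂, ‖gradY f x y₁ - gradY f x y₂‖ ≤ Ly * ‖y₁ - y₂‖
  gradY_g_lip_x : ∀ x₁ x₂ y, ‖gradY g x₁ y - gradY g x₂ y‖ ≤ Lgxy * ‖x₁ - x₂‖
  gradY_g_lip_y : ∀ x y₁ y₂, ‖gradY g x y₁ - gradY g x y₂‖ ≤ Lgy * ‖y₁ - y₂‖
  jacXY_g_lip : ∀ x₁ y₁ x₂ y₂,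
    ‖jacXY g x₁ y₁ - jacXY g x₂ y₂‖ ≤ ρxy * √(‖x₁ - x₂‖ ^ 2 + ‖y₁ - y₂‖ ^ 2)
  hessY_g_lip : ∀ x₁ y₁ x₂ y₂,
    ‖hessY g x₁ y₁ - hessY g x₂ y₂‖ ≤ ρyy * √(‖x₁ - x₂‖ ^ 2 + ‖y₁ - y₂‖ ^ 2)
  g_strongConvex : ∀ x, StrongConvexOn Set.univ μy (g x)
  objective_strongConvex : StrongConvexOn Set.univ μx (objective f g)
  exists_min : ∃ xs : E p, IsMinOn (objective f g) Set.univ xs ∧ ∃ B : ℝ, 0 < B ∧ ‖xs‖ = B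

/-- The smoothness parameter `L_Φ` of `Φ` when `‖∇_y f‖ ≤ U`. -/
def smoothPhi (Lx Lxy Ly Lgxy ρxy ρyy U μy : ℝ) : ℝ :=
  Lx + 2 * Lxy * Lgxy / μy
    + (U * ρxy / μy + U * Lgxy * ρyy / μy ^ 2) * (1 + Lgxy / μy)
    + Lgxy ^ 2 * Ly / μy ^ 2

/-! ### The algorithm, with counters for the oracle calls -/

/-- State of the inner accelerated gradient loop: the iterates `yᵗ, sᵗ` and the number of
evaluations of `∇_y g` made so far. -/
structure AGDState (q : ℕ) where
  y : E q
  s : E q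
  nG : ℕ

/-- One step of accelerated gradient descent for a function with gradient `dg`:
`yᵗ = sᵗ⁻¹ - dg(sᵗ⁻¹) / L`, `sᵗ = 2√κ/(√κ+1) yᵗ - (√κ-1)/(√κ+1) yᵗ⁻¹`. -/
def agdStep (L κ : ℝ) (dg : E q → E q) (S : AGDState q) : AGDState q :=
  let y' := S.s - (1 / L) • dg S.s
  { y := y'
    s := (2 * √κ / (√κ + 1)) • y' - ((√κ - 1) / (√κ + 1)) • S.y
    nG := S.nG + 1 }

/-- State of the heavy-ball loop: `vᵗ`, `vᵗ⁻¹` and the number of Hessian-vector products so far. -/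
structure HBState (q : ℕ) where
  v : E q
  vPrev : E q
  nH : ℕ

/-- One heavy-ball step `vᵗ⁺¹ = vᵗ - lam ∇Q(vᵗ) + θ (vᵗ - vᵗ⁻¹)` for
`Q(v) = ½ vᵀ H v - vᵀ b`, so `∇Q(v) = H v - b`. -/
def hbStep (lam θ : ℝ) (H : E q →L[ℝ] E q) (b : E q) (S : HBState q) : HBState q :=
  { v := S.v - lam • (H S.v - b) + θ • (S.v - S.vPrev)
    vPrev := S.v
    nH := S.nH + 1 }

/-- Parameters of the algorithm: `L, κ` are the ones of the inner loop, `lam, θ` the ones of the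
heavy-ball method, `η, τ, α, β` the ones of the outer updates, `N` and `M` the lengths of the two
inner loops. -/
structure Params where
  L : ℝ
  κ : ℝ
  lam : ℝ
  θ : ℝ
  η : ℕ → ℝ
  τ : ℕ → ℝ
  α : ℕ → ℝ
  β : ℕ → ℝ
  N : ℕ
  M : ℕ

/-- State of the outer loop after `k` iterations: `x_k`, `z_k`, the warm start `y_k⁰ = y_{k-1}ᴺ`
(`0` for `k = 0`), and the numbers of gradient evaluations, Jacobian-vector products and
Hessian-vector products made so far. -/
structure State (p q : ℕ) where
  x : E p
  z : E p
  y : E q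
  nG : ℕ
  nJ : ℕ
  nH : ℕ

/-- Iteration `k` of AccBiO-BG. The heavy-ball loop starts from `v⁰ = v¹ = 0`, so `v^M` is reached
after `M - 1` further updates. Besides those of the inner loop, the gradients `∇ₓ f` and `∇_y f` are
evaluated once each. -/
def accBiOBGStep (P : Params) (f g : E p → E q → ℝ) (k : ℕ) (S : State p q) : State p q :=
  let xt := P.η k • S.x + (1 - P.η k) • S.z
  let inner := (agdStep P.L P.κ (gradY g xt))^[P.N] { y := S.y, s := S.y, nG := 0 }
  let yN := inner.y
  let hb := (hbStep P.lam P.θ (hessY g xt yN) (gradY f xt yN))^[P.M - 1]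
    { v := 0, vPrev := 0, nH := 0 }
  let G := gradX f xt yN - jacXY g xt yN hb.v
  { x := P.τ k • xt + (1 - P.τ k) • S.x - P.β k • G
    z := xt - P.α k • G
    y := yN
    nG := S.nG + inner.nG + 2
    nJ := S.nJ + 1
    nH := S.nH + hb.nH }

/-- AccBiO-BG started from `x₀ = z₀ = 0`, `y₀ = 0`: the state after `k` outer iterations. -/
def accBiOBG (P : Params) (f g : E p → E q → ℝ) : ℕ → State p q
  | 0 => { x := 0, z := 0, y := 0, nG := 0, nJ := 0, nH := 0 }
  | k + 1 => accBiOBGStep P f g k (accBiOBG P f g k)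

/-- The complexity `t (n_J + n_H) + n_G`, where `t` is the relative cost of a Jacobian- or
Hessian-vector product. -/
def State.complexity (t : ℝ) (S : State p q) : ℝ :=
  t * ((S.nJ : ℝ) + S.nH) + S.nG

/-- The parameter choice for the strongly-convex–strongly-convex class with outer stepsize `α`. -/
def scscParams (Lgy μx μy α : ℝ) (N M : ℕ) : Params :=
  let lam := 4 / (√Lgy + √μy) ^ 2
  { L := Lgy
    κ := Lgy / μy
    lam := lam
    θ := max ((1 - √(lam * μy)) ^ 2) ((1 - √(lam * Lgy)) ^ 2)
    η := fun _ => √(α * μx) / (√(α * μx) + 2)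
    τ := fun _ => √(α * μx) / 2
    α := fun _ => α
    β := fun _ => √(α / μx)
    N := N
    M := M }

end Bilevel

end

/-!
Strong convexity of `g(x, ·)` makes `y*` Lipschitz with constant `L̃_{xy} / μ_y`, and the derivative
of the optimality condition `∇_y g(x, y*(x)) = 0` gives
`∇Φ(x) = ∇ₓ f - ∇ₓ∇_y g (∇²_y g)⁻¹ ∇_y f` at `y = y*(x)`. The same expression at `(x, y)` is
Lipschitz in `y`, so the direction `G_k` differs from `∇Φ(x̃_k)` by a multiple of
`‖y_kᴺ - y*(x̃_k)‖` plus the heavy-ball error, which is exponentially small in `M`.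

An accelerated step on the `μₓ`-strongly convex `Φ` with an inexact gradient contracts the potential
`Φ(z) - Φ(x*) + μₓ/4 ‖x - x*‖²` by `1 - τ/2`, up to the squared gradient error, and leaves a
negative multiple of `‖x̃_k - x*‖²`. This surplus pays for the drift of the target `y*(x̃_k)`: once
a small multiple of `‖y - y*(x*)‖²` is added to the potential, and `N` is so large that the inner
loop reduces the warm-start error by a fixed factor, the sum is contracted by `1 - τ/2` up to the
heavy-ball error. So `K` and `M` grow only logarithmically in `1/ε`, and with `N` of the order
`√κ_y log (1/ε)`, uniformly in `k`, `Δ` and `r`, the complexity is of the order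
`(√κ_y / τ) log² (1/ε)`. Here `√κ_y / τ ≤ 2 √(L_Φ L̃_y / (c μₓ μ_y))`, and `L_Φ μ_y³` is bounded for
bounded `μ_y`.
-/

noncomputable section

namespace Bilevel

open Filter Topology Asymptotics

section Convexity

variable {F : Type*} [NormedAddCommGroup F] [InnerProductSpace ℝ F] {φ : F → ℝ} {d : F → F}
  {L μ : ℝ}

/-- The first-order inequality `φ(y) ≥ φ(x) + ⟨d(x), y - x⟩ + μ/2 ‖y - x‖²`. For `d = ∇φ` it is
equivalent to `μ`-strong convexity, and it is the only form in which the convergence proofs use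
strong convexity. -/
def QuadraticLowerBound (μ : ℝ) (φ : F → ℝ) (d : F → F) : Prop :=
  ∀ x y, φ x + inner ℝ (d x) (y - x) + μ / 2 * ‖y - x‖ ^ 2 ≤ φ y

/-- The first-order inequality `φ(y) ≤ φ(x) + ⟨d(x), y - x⟩ + L/2 ‖y - x‖²`, the only form in which
the convergence proofs use the `L`-Lipschitz continuity of `d = ∇φ`. -/
def QuadraticUpperBound (L : ℝ) (φ : F → ℝ) (d : F → F) : Prop :=
  ∀ x y, φ y ≤ φ x + inner ℝ (d x) (y - x) + L / 2 * ‖y - x‖ ^ 2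

theorem hasDerivAt_add_smul (x v : F) (s : ℝ) : HasDerivAt (fun t : ℝ => x + t • v) v s := by
  simpa using ((hasDerivAt_id s).smul_const v).const_add x

theorem hasDerivAt_comp_add_smul [CompleteSpace F] {e x v : F} {s : ℝ}
    (h : HasGradientAt φ e (x + s • v)) :
    HasDerivAt (fun t : ℝ => φ (x + t • v)) (inner ℝ e v) s := by
  have hcomp := h.hasFDerivAt.comp_hasDerivAt s (hasDerivAt_add_smul x v s)
  rwa [InnerProductSpace.toDual_apply_apply] at hcomp

theorem quadraticLowerBound_of_strongConvexOn [CompleteSpace F]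
    (hφ : StrongConvexOn Set.univ μ φ) (hd : ∀ x, HasGradientAt φ (d x) x) :
    QuadraticLowerBound μ φ d := by
  intro x y
  have hconvex : ConvexOn ℝ Set.univ fun t : ℝ =>
      φ (x + t • (y - x)) - μ / 2 * ‖x + t • (y - x)‖ ^ 2 := by
    have h := (strongConvexOn_iff_convex.1 hφ).comp_affineMap (AffineMap.lineMap x y)
    simpa [Function.comp_def, AffineMap.lineMap_apply, add_comm] using h
  have hderiv : HasDerivAt (fun t : ℝ => φ (x + t • (y - x)) - μ / 2 * ‖x + t • (y - x)‖ ^ 2)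
      (inner ℝ (d x) (y - x) - μ / 2 * (2 * inner ℝ x (y - x))) 0 := by
    have hφ' := hasDerivAt_comp_add_smul (v := y - x) (s := 0) (by simpa using hd x)
    have hsq := (hasDerivAt_add_smul x (y - x) 0).norm_sq.const_mul (μ / 2)
    exact (hφ'.sub hsq).congr_deriv (by simp only [zero_smul, add_zero])
  have hslope := hconvex.le_slope_of_hasDerivAt (Set.mem_univ 0) (Set.mem_univ 1) one_pos hderiv
  have hnorm := norm_add_sq_real x (y - x)
  simp only [slope_def_field, one_smul, zero_smul, add_zero, sub_zero, div_one] at hslope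
  rw [hnorm, add_sub_cancel] at hslope
  linarith

theorem quadraticUpperBound_of_lipschitz_gradient [CompleteSpace F]
    (hd : ∀ x, HasGradientAt φ (d x) x) (hL : ∀ x y, ‖d x - d y‖ ≤ L * ‖x - y‖) :
    QuadraticUpperBound L φ d := by
  intro x y
  set v := y - x with hv
  let gap : ℝ → ℝ := fun t => φ (x + t • v) - t * inner ℝ (d x) v - t ^ 2 * (L / 2 * ‖v‖ ^ 2)
  have hderiv : ∀ s, HasDerivAt gap
      (inner ℝ (d (x + s • v) - d x) v - s * (L * ‖v‖ ^ 2)) s := by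
    intro s
    have hlin := (hasDerivAt_id s).mul_const (inner ℝ (d x) v)
    have hsq := (hasDerivAt_pow 2 s).mul_const (L / 2 * ‖v‖ ^ 2)
    refine (((hasDerivAt_comp_add_smul (hd (x + s • v))).sub hlin).sub hsq).congr_deriv ?_
    rw [inner_sub_left]
    push_cast
    ring
  have hanti : AntitoneOn gap (Set.Icc 0 1) := by
    refine antitoneOn_of_deriv_nonpos (convex_Icc 0 1)
      (fun s _ => (hderiv s).continuousAt.continuousWithinAt)
      (fun s _ => (hderiv s).differentiableAt.differentiableWithinAt) fun s hs => ?_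
    rw [interior_Icc] at hs
    have hinner := real_inner_le_norm (d (x + s • v) - d x) v
    have hlip := hL (x + s • v) x
    rw [add_sub_cancel_left, norm_smul, Real.norm_of_nonneg hs.1.le] at hlip
    rw [(hderiv s).deriv]
    nlinarith [norm_nonneg v]
  have hends := hanti (Set.left_mem_Icc.2 zero_le_one) (Set.right_mem_Icc.2 zero_le_one) zero_le_one
  simp only [gap, hv, one_smul, zero_smul, add_zero, add_sub_cancel] at hends
  linarith

theorem mul_norm_le_norm_of_mul_norm_sq_le_inner {u v : F} (h : μ * ‖u‖ ^ 2 ≤ inner ℝ v u) :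
    μ * ‖u‖ ≤ ‖v‖ := by
  rcases eq_or_ne u 0 with rfl | hu
  · simp
  · refine le_of_mul_le_mul_right ?_ (norm_pos_iff.2 hu)
    linarith [real_inner_le_norm v u]

theorem mul_norm_sq_le_inner_of_hasFDerivAt {d' : F →L[ℝ] F} {x : F} (hd' : HasFDerivAt d d' x)
    (hmono : ∀ y z, μ * ‖y - z‖ ^ 2 ≤ inner ℝ (d y - d z) (y - z)) (u : F) :
    μ * ‖u‖ ^ 2 ≤ inner ℝ (d' u) u := by
  have hline : HasDerivAt (fun t : ℝ => d (x + t • u)) (d' u) 0 :=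
    HasFDerivAt.comp_hasDerivAt 0 (by simpa using hd') (hasDerivAt_add_smul x u 0)
  have hslope : Tendsto (fun t : ℝ => t⁻¹ * inner ℝ (d (x + t • u) - d x) u) (𝓝[>] 0)
      (𝓝 (inner ℝ (d' u) u)) := by
    simpa [real_inner_smul_left] using
      hline.tendsto_slope_zero_right.inner (𝕜 := ℝ) (tendsto_const_nhds (x := u))
  refine ge_of_tendsto hslope ?_
  filter_upwards [self_mem_nhdsWithin] with t (ht : 0 < t)
  have hstep := hmono (x + t • u) x
  rw [add_sub_cancel_left, norm_smul, inner_smul_right, Real.norm_of_nonneg ht.le] at hstep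
  rw [inv_mul_eq_div, le_div_iff₀ ht]
  exact le_of_mul_le_mul_left (by linarith) ht

namespace QuadraticLowerBound

theorem mul_norm_sub_sq_le_inner (h : QuadraticLowerBound μ φ d) (x y : F) :
    μ * ‖x - y‖ ^ 2 ≤ inner ℝ (d x - d y) (x - y) := by
  have hxy := h x y
  have hyx := h y x
  rw [norm_sub_rev, ← neg_sub x y, inner_neg_right] at hxy
  rw [inner_sub_left]
  linarith

theorem mul_norm_sub_le (h : QuadraticLowerBound μ φ d) (x y : F) :
    μ * ‖x - y‖ ≤ ‖d x - d y‖ :=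
  mul_norm_le_norm_of_mul_norm_sq_le_inner (h.mul_norm_sub_sq_le_inner x y)

theorem exists_isMinOn [ProperSpace F] (h : QuadraticLowerBound μ φ d) (hμ : 0 < μ)
    (hφ : Continuous φ) : ∃ x, IsMinOn φ Set.univ x := by
  suffices hfar : ∀ᶠ y in cocompact F, φ 0 ≤ φ y by
    obtain ⟨x, hx⟩ := hφ.exists_forall_le' 0 hfar
    exact ⟨x, fun y _ => hx y⟩
  filter_upwards [(tendsto_norm_cocompact_atTop (E := F)).eventually_ge_atTop (2 * ‖d 0‖ / μ)]
    with y hy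
  have hbound := h 0 y
  have hinner := neg_le_of_abs_le (abs_real_inner_le_norm (d 0) y)
  rw [sub_zero] at hbound
  rw [div_le_iff₀ hμ] at hy
  nlinarith [norm_nonneg y]

end QuadraticLowerBound

theorem QuadraticUpperBound.apply_sub_smul_self_le (h : QuadraticUpperBound L φ d) (hL : 0 < L)
    (x : F) : φ (x - (1 / L) • d x) ≤ φ x - 1 / (2 * L) * ‖d x‖ ^ 2 := by
  have hstep := h x (x - (1 / L) • d x)
  rw [sub_sub_cancel_left, inner_neg_right, inner_smul_right, real_inner_self_eq_norm_sq, norm_neg,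
    norm_smul, mul_pow, Real.norm_eq_abs, sq_abs] at hstep
  refine hstep.trans (le_of_eq ?_)
  field_simp
  ring

theorem QuadraticUpperBound.apply_sub_smul_le (h : QuadraticUpperBound L φ d) {α : ℝ} (hα : 0 ≤ α)
    (hαL : α * L ≤ 1 / 2) (x G : F) :
    φ (x - α • G) ≤ φ x + α / 2 * ‖G - d x‖ ^ 2 - α / 4 * ‖G‖ ^ 2 := by
  have hstep := h x (x - α • G)
  rw [sub_sub_cancel_left, inner_neg_right, inner_smul_right, norm_neg, norm_smul, mul_pow,
    Real.norm_eq_abs, sq_abs] at hstep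
  have herr := norm_sub_sq_real G (d x)
  rw [real_inner_comm] at herr
  have hcurv : α * (α * L) * ‖G‖ ^ 2 ≤ α * (1 / 2) * ‖G‖ ^ 2 := by gcongr
  have hnonneg : 0 ≤ α / 2 * ‖d x‖ ^ 2 := by positivity
  rw [herr]
  linarith

end Convexity

section Acceleration

variable {F : Type*} [NormedAddCommGroup F] [InnerProductSpace ℝ F] {φ : F → ℝ} {d : F → F}
  {L μ τ : ℝ} {x xs xt z G : F}

/-- The Lyapunov function of an accelerated gradient method with minimizer `xs`, descent iterate `z`
and momentum iterate `x`. -/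
def accelPotential (w : ℝ) (φ : F → ℝ) (xs x z : F) : ℝ :=
  φ z - φ xs + w / 2 * ‖x - xs‖ ^ 2

theorem norm_sq_smul_add_smul_le (hτ0 : 0 ≤ τ) (hτ1 : τ ≤ 1) (a b : F) :
    ‖(1 - τ) • a + τ • b‖ ^ 2 ≤ (1 - τ) * ‖a‖ ^ 2 + τ * ‖b‖ ^ 2 := by
  have hconvex : ConvexOn ℝ Set.univ fun a : F => ‖a‖ ^ 2 :=
    convexOn_univ_norm.pow (fun a _ => norm_nonneg a) 2
  exact hconvex.2 (Set.mem_univ a) (Set.mem_univ b) (sub_nonneg.2 hτ1) hτ0 (sub_add_cancel 1 τ)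

/-- The two lower bounds at the extrapolated point `xt`, towards `z` and towards `xs`, combined with
weights `1 - τ` and `τ`: the coupling `τ (x - xt) = xt - z` turns the linear terms into the inner
product with the averaged momentum error. -/
theorem QuadraticLowerBound.coupling (h : QuadraticLowerBound μ φ d) (hμ : 0 ≤ μ) (hτ0 : 0 ≤ τ)
    (hτ1 : τ ≤ 1) (hxt : τ • (x - xt) = xt - z) (xs : F) :
    φ xt - τ * inner ℝ (d xt) ((1 - τ) • (x - xs) + τ • (xt - xs)) + τ * μ / 2 * ‖xt - xs‖ ^ 2
      ≤ (1 - τ) * φ z + τ * φ xs := by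
  have hz : φ xt + inner ℝ (d xt) (z - xt) ≤ φ z :=
    (le_add_of_nonneg_right (by positivity)).trans (h xt z)
  have hs := h xt xs
  have hlin : τ * inner ℝ (d xt) ((1 - τ) • (x - xs) + τ • (xt - xs))
      = -((1 - τ) * inner ℝ (d xt) (z - xt) + τ * inner ℝ (d xt) (xs - xt)) := by
    have hz' : z = xt - τ • (x - xt) := by rw [hxt, sub_sub_cancel]
    rw [hz']
    simp only [← inner_smul_right, ← inner_add_right, ← inner_neg_right]
    congr 1
    module
  rw [norm_sub_rev] at hs
  linarith [mul_le_mul_of_nonneg_left hz (sub_nonneg.2 hτ1), mul_le_mul_of_nonneg_left hs hτ0]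

theorem QuadraticLowerBound.accelPotential_momentum_step_le (h : QuadraticLowerBound μ φ d)
    (hμ : 0 ≤ μ) (hτ0 : 0 ≤ τ) (hτ1 : τ ≤ 1) {w β : ℝ} (hw : 0 ≤ w) (hwβ : w * β = τ)
    (hxt : τ • (x - xt) = xt - z) (xs G : F) :
    accelPotential w φ xs (τ • xt + (1 - τ) • x - β • G) xt
      ≤ (1 - τ) * accelPotential w φ xs x z + τ * β / 2 * ‖G‖ ^ 2
        - τ * inner ℝ (G - d xt) ((1 - τ) • (x - xs) + τ • (xt - xs))
        - (μ - w) / 2 * τ * ‖xt - xs‖ ^ 2 := by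
  set u := (1 - τ) • (x - xs) + τ • (xt - xs) with hu
  have hmomentum : τ • xt + (1 - τ) • x - β • G - xs = u - β • G := by rw [hu]; module
  have hexpand : w / 2 * ‖u - β • G‖ ^ 2
      = w / 2 * ‖u‖ ^ 2 - τ * inner ℝ G u + τ * β / 2 * ‖G‖ ^ 2 := by
    rw [norm_sub_sq_real, inner_smul_right, norm_smul, mul_pow, Real.norm_eq_abs, sq_abs,
      real_inner_comm, ← hwβ]
    ring
  have hnorm := mul_le_mul_of_nonneg_left
    (norm_sq_smul_add_smul_le hτ0 hτ1 (x - xs) (xt - xs)) (div_nonneg hw zero_le_two)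
  have hcoupling := h.coupling hμ hτ0 hτ1 hxt xs
  rw [← hu] at hnorm hcoupling
  rw [accelPotential, accelPotential, hmomentum, hexpand, inner_sub_left]
  linarith

theorem neg_inner_le_of_pos (hμ : 0 < μ) (e u : F) :
    -inner ℝ e u ≤ 2 / μ * ‖e‖ ^ 2 + μ / 8 * ‖u‖ ^ 2 := by
  have hinner := neg_le_of_abs_le (abs_real_inner_le_norm e u)
  have hsq : μ / 8 * (4 / μ * ‖e‖ - ‖u‖) ^ 2
      = 2 / μ * ‖e‖ ^ 2 + μ / 8 * ‖u‖ ^ 2 - ‖e‖ * ‖u‖ := by field_simp; ring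
  have hnonneg : 0 ≤ μ / 8 * (4 / μ * ‖e‖ - ‖u‖) ^ 2 := by positivity
  linarith

/-- One outer iteration with an arbitrary direction `G` in place of the gradient. The decrease of
`‖xt - xs‖²` is kept: it pays for the displacement of the lower-level solution. -/
theorem accelPotential_inexact_step_le (hlower : QuadraticLowerBound μ φ d)
    (hupper : QuadraticUpperBound L φ d) (hμ : 0 < μ) (hτ0 : 0 < τ) (hτ : τ ≤ 1 / 2)
    (hτL : 8 * τ ^ 2 * L ≤ μ) (hxs : IsMinOn φ Set.univ xs) (hxt : τ • (x - xt) = xt - z) (G : F) :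
    accelPotential (μ / 2) φ xs (τ • xt + (1 - τ) • x - (2 * τ / μ) • G)
        (xt - (4 * τ ^ 2 / μ) • G)
      ≤ (1 - τ / 2) * accelPotential (μ / 2) φ xs x z + 3 * τ / μ * ‖G - d xt‖ ^ 2
        - τ * μ / 8 * ‖xt - xs‖ ^ 2 := by
  have hdescent := hupper.apply_sub_smul_le (α := 4 * τ ^ 2 / μ) (by positivity)
    (by rw [div_mul_eq_mul_div, div_le_iff₀ hμ]; linarith) xt G
  have hmomentum := hlower.accelPotential_momentum_step_le hμ.le hτ0.le (by linarith)
    (half_pos hμ).le (β := 2 * τ / μ) (by field_simp) hxt xs G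
  have hyoung := neg_inner_le_of_pos hμ (G - d xt) ((1 - τ) • (x - xs) + τ • (xt - xs))
  have hnorm := norm_sq_smul_add_smul_le hτ0.le (by linarith) (x - xs) (xt - xs)
  have hcross : -(τ * inner ℝ (G - d xt) ((1 - τ) • (x - xs) + τ • (xt - xs)))
      ≤ 2 * τ / μ * ‖G - d xt‖ ^ 2
        + τ * μ / 8 * ((1 - τ) * ‖x - xs‖ ^ 2 + τ * ‖xt - xs‖ ^ 2) := by
    calc _ = τ * -inner ℝ (G - d xt) ((1 - τ) • (x - xs) + τ • (xt - xs)) := by ring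
      _ ≤ τ * (2 / μ * ‖G - d xt‖ ^ 2
          + μ / 8 * ((1 - τ) * ‖x - xs‖ ^ 2 + τ * ‖xt - xs‖ ^ 2)) := by
        gcongr; exact hyoung.trans (by gcongr)
      _ = _ := by ring
  have hstep : 2 * τ ^ 2 / μ * ‖G - d xt‖ ^ 2 ≤ τ / μ * ‖G - d xt‖ ^ 2 := by gcongr; nlinarith
  have hgap : 0 ≤ τ * (φ z - φ xs) := mul_nonneg hτ0.le (sub_nonneg.2 (hxs (Set.mem_univ z)))
  have hx : 0 ≤ τ * τ * μ * ‖x - xs‖ ^ 2 := by positivity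
  have hxt' : 0 ≤ τ * (1 - τ) * μ * ‖xt - xs‖ ^ 2 := by
    have : 0 ≤ 1 - τ := by linarith
    positivity
  simp only [accelPotential] at hmomentum ⊢
  linear_combination hdescent + hmomentum + hcross + hstep + hgap / 2 + hx / 8 + hxt' / 8

end Acceleration

section AcceleratedGradient

variable {q : ℕ} {φ : E q → ℝ} {d : E q → E q} {L μ : ℝ}

/-- The momentum iterate of Nesterov's method, recovered from the pair `(y, s)` that `agdStep`
stores. -/
def AGDState.momentum (κ : ℝ) (S : AGDState q) : E q := S.s + √κ • (S.s - S.y)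

theorem AGDState.momentum_agdStep {κ : ℝ} (hκ : 0 < κ) (L : ℝ) (d : E q → E q) (S : AGDState q) :
    (agdStep L κ d S).momentum κ
      = (1 / √κ) • S.s + (1 - 1 / √κ) • S.momentum κ - (√κ / L) • d S.s := by
  have : 0 < √κ := Real.sqrt_pos.2 hκ
  simp only [momentum, agdStep]
  match_scalars <;> field_simp <;> ring

theorem one_le_sqrt_div (hμ : 0 < μ) (hμL : μ ≤ L) : 1 ≤ √(L / μ) :=
  Real.one_le_sqrt.2 ((one_le_div hμ).2 hμL)

theorem accelPotential_agdStep_le (hμ : 0 < μ) (hμL : μ ≤ L) (hlower : QuadraticLowerBound μ φ d)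
    (hupper : QuadraticUpperBound L φ d) (ys : E q) (S : AGDState q) :
    accelPotential μ φ ys ((agdStep L (L / μ) d S).momentum (L / μ)) (agdStep L (L / μ) d S).y
      ≤ (1 - 1 / √(L / μ)) * accelPotential μ φ ys (S.momentum (L / μ)) S.y := by
  have hL : 0 < L := hμ.trans_le hμL
  have hsq : √(L / μ) ^ 2 = L / μ := Real.sq_sqrt (by positivity)
  have hone : 1 ≤ √(L / μ) := one_le_sqrt_div hμ hμL
  have hmomentum_step := AGDState.momentum_agdStep (div_pos hL hμ) L d S
  set k := √(L / μ) with hk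
  have hkpos : 0 < k := by linarith
  have hLk : L = k ^ 2 * μ := by rw [hsq]; field_simp
  have hmomentum := hlower.accelPotential_momentum_step_le hμ.le (by positivity)
    ((div_le_one hkpos).2 hone) hμ.le (β := k / L) (by rw [hLk]; field_simp)
    (x := S.momentum (L / μ)) (xt := S.s) (z := S.y)
    (by rw [AGDState.momentum, ← hk]; match_scalars <;> field_simp; ring) ys (d S.s)
  rw [← hmomentum_step, sub_self, inner_zero_left] at hmomentum
  have hdescent : φ (agdStep L (L / μ) d S).y ≤ φ S.s - 1 / (2 * L) * ‖d S.s‖ ^ 2 :=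
    hupper.apply_sub_smul_self_le hL S.s
  have hcoeff : 1 / k * (k / L) / 2 = 1 / (2 * L) := by field_simp
  rw [hcoeff] at hmomentum
  simp only [accelPotential] at hmomentum ⊢
  linarith

theorem iterate_agdStep_nG (L κ : ℝ) (d : E q → E q) (N : ℕ) (S : AGDState q) :
    ((agdStep L κ d)^[N] S).nG = S.nG + N := by
  induction N with
  | zero => rfl
  | succ n ih => rw [Function.iterate_succ_apply', agdStep, ih, add_assoc]

theorem one_sub_pow_le_exp {s : ℝ} (hs : s ≤ 1) (n : ℕ) : (1 - s) ^ n ≤ Real.exp (-(n * s)) := by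
  rw [← mul_neg, Real.exp_nat_mul]
  exact pow_le_pow_left₀ (sub_nonneg.2 hs) (Real.one_sub_le_exp_neg s) n

theorem accelPotential_iterate_agdStep_le (hμ : 0 < μ) (hμL : μ ≤ L)
    (hlower : QuadraticLowerBound μ φ d) (hupper : QuadraticUpperBound L φ d) (ys : E q)
    (S : AGDState q) (N : ℕ) :
    accelPotential μ φ ys (((agdStep L (L / μ) d)^[N] S).momentum (L / μ))
        ((agdStep L (L / μ) d)^[N] S).y
      ≤ (1 - 1 / √(L / μ)) ^ N * accelPotential μ φ ys (S.momentum (L / μ)) S.y := by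
  have hone := one_le_sqrt_div hμ hμL
  induction N with
  | zero => simp
  | succ n ih =>
    rw [Function.iterate_succ_apply', pow_succ', mul_assoc]
    exact (accelPotential_agdStep_le hμ hμL hlower hupper ys _).trans
      (mul_le_mul_of_nonneg_left ih (sub_nonneg.2 ((div_le_one (by linarith)).2 hone)))

theorem norm_iterate_agdStep_sub_sq_le (hμ : 0 < μ) (hμL : μ ≤ L)
    (hlower : QuadraticLowerBound μ φ d) (hupper : QuadraticUpperBound L φ d) {ys : E q}
    (hys : d ys = 0) (y₀ : E q) (N : ℕ) :
    ‖((agdStep L (L / μ) d)^[N] ⟨y₀, y₀, 0⟩).y - ys‖ ^ 2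
      ≤ (L / μ + 1) * Real.exp (-(N / √(L / μ))) * ‖y₀ - ys‖ ^ 2 := by
  have hone := one_le_sqrt_div hμ hμL
  have hdecay := accelPotential_iterate_agdStep_le hμ hμL hlower hupper ys ⟨y₀, y₀, 0⟩ N
  set S := (agdStep L (L / μ) d)^[N] ⟨y₀, y₀, 0⟩
  have hfinal : μ / 2 * ‖S.y - ys‖ ^ 2 ≤ accelPotential μ φ ys (S.momentum (L / μ)) S.y := by
    have hstart := hlower ys S.y
    have hmomentum : 0 ≤ μ / 2 * ‖S.momentum (L / μ) - ys‖ ^ 2 := by positivity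
    rw [hys, inner_zero_left] at hstart
    rw [accelPotential]
    linarith
  have hinitial : accelPotential μ φ ys (AGDState.momentum (L / μ) ⟨y₀, y₀, 0⟩) y₀
      ≤ (L + μ) / 2 * ‖y₀ - ys‖ ^ 2 := by
    have hstart := hupper ys y₀
    rw [hys, inner_zero_left] at hstart
    simp only [accelPotential, AGDState.momentum, sub_self, smul_zero, add_zero]
    linarith
  have hrate : (1 - 1 / √(L / μ)) ^ N ≤ Real.exp (-(N / √(L / μ))) := by
    simpa only [mul_one_div] using one_sub_pow_le_exp ((div_le_one (by linarith)).2 hone) N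
  have hnonneg : 0 ≤ (1 - 1 / √(L / μ)) ^ N :=
    pow_nonneg (sub_nonneg.2 ((div_le_one (by linarith)).2 hone)) N
  calc ‖S.y - ys‖ ^ 2 = 2 / μ * (μ / 2 * ‖S.y - ys‖ ^ 2) := by field_simp
    _ ≤ 2 / μ * ((1 - 1 / √(L / μ)) ^ N * ((L + μ) / 2 * ‖y₀ - ys‖ ^ 2)) := by
      refine mul_le_mul_of_nonneg_left ?_ (by positivity)
      exact (hfinal.trans hdecay).trans (mul_le_mul_of_nonneg_left hinitial hnonneg)
    _ = (L / μ + 1) * (1 - 1 / √(L / μ)) ^ N * ‖y₀ - ys‖ ^ 2 := by field_simp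
    _ ≤ _ := by have := hμ.trans_le hμL; gcongr

end AcceleratedGradient

section HeavyBall

section Recurrence

variable {F : Type*} [NormedAddCommGroup F] [InnerProductSpace ℝ F] {A : F →L[ℝ] F} {r : ℝ}

/-- The quadratic form that the error recurrence `(e, p) ↦ (A e - r² p, e)` of the heavy-ball method
multiplies by exactly `r²`. -/
def heavyBallEnergy (A : F →L[ℝ] F) (r : ℝ) (e p : F) : ℝ :=
  ‖e‖ ^ 2 - inner ℝ e (A p) + r ^ 2 * ‖p‖ ^ 2

theorem heavyBallEnergy_step (hA : A.IsSymmetric) (r : ℝ) (e p : F) :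
    heavyBallEnergy A r (A e - r ^ 2 • p) e = r ^ 2 * heavyBallEnergy A r e p := by
  have hinner : inner ℝ (A e - r ^ 2 • p) (A e)
      = ‖A e - r ^ 2 • p‖ ^ 2 + r ^ 2 * inner ℝ (A e - r ^ 2 • p) p := by
    rw [← real_inner_self_eq_norm_sq, ← inner_smul_right, ← inner_add_right, sub_add_cancel]
  have hsymm : inner ℝ (A e) p = inner ℝ e (A p) := hA e p
  rw [heavyBallEnergy, heavyBallEnergy, hinner, inner_sub_left, real_inner_smul_left,
    real_inner_self_eq_norm_sq, hsymm]
  ring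

theorem norm_le_of_heavyBallEnergy_le (hA : ‖A‖ ≤ 2 * r) {e p : F} {s : ℝ} (hs : 0 ≤ s)
    (henergy : heavyBallEnergy A r e p ≤ s ^ 2) : ‖e‖ ≤ r * ‖p‖ + s := by
  have hAp : ‖(1 / 2 : ℝ) • A p‖ ≤ r * ‖p‖ := by
    rw [norm_smul, Real.norm_of_nonneg (by norm_num)]
    linarith [A.le_of_opNorm_le hA p]
  have hdist : ‖e - (1 / 2 : ℝ) • A p‖ ≤ s := by
    refine abs_le_of_sq_le_sq' ?_ hs |>.2
    rw [norm_sub_sq_real, inner_smul_right]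
    have hsq := pow_le_pow_left₀ (norm_nonneg _) hAp 2
    rw [heavyBallEnergy] at henergy
    linarith
  linarith [norm_le_norm_add_norm_sub' e ((1 / 2 : ℝ) • A p)]

theorem norm_le_of_heavyBall_recurrence (hsymm : A.IsSymmetric) (hA : ‖A‖ ≤ 2 * r) (hr0 : 0 ≤ r)
    (hr1 : r ≤ 1) {u : ℕ → F} (hu1 : u 1 = u 0)
    (hu : ∀ n, u (n + 2) = A (u (n + 1)) - r ^ 2 • u n) (n : ℕ) :
    ‖u (n + 1)‖ ≤ (2 * n + 1) * r ^ n * ‖u 0‖ := by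
  have henergy : ∀ n, heavyBallEnergy A r (u (n + 1)) (u n) ≤ (r ^ n * (2 * ‖u 0‖)) ^ 2 := by
    intro n
    induction n with
    | zero =>
      have hinner := neg_le_of_abs_le (abs_real_inner_le_norm (u 0) (A (u 0)))
      have hAu := mul_le_mul_of_nonneg_left (A.le_of_opNorm_le hA (u 0)) (norm_nonneg (u 0))
      have hr : (1 + r) ^ 2 * ‖u 0‖ ^ 2 ≤ 2 ^ 2 * ‖u 0‖ ^ 2 := by gcongr; linarith
      rw [zero_add, hu1, heavyBallEnergy]
      linarith
    | succ n ih =>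
      rw [hu, heavyBallEnergy_step hsymm]
      calc r ^ 2 * _ ≤ r ^ 2 * (r ^ n * (2 * ‖u 0‖)) ^ 2 := by gcongr
        _ = _ := by ring
  induction n with
  | zero => simp [hu1]
  | succ n ih =>
    calc ‖u (n + 2)‖ ≤ r * ‖u (n + 1)‖ + r ^ (n + 1) * (2 * ‖u 0‖) :=
          norm_le_of_heavyBallEnergy_le hA (by positivity) (henergy (n + 1))
      _ ≤ r * ((2 * n + 1) * r ^ n * ‖u 0‖) + r ^ (n + 1) * (2 * ‖u 0‖) := by gcongr
      _ = _ := by push_cast; ring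

theorem isSymmetric_smul_id_sub_smul (hA : A.IsSymmetric) (a b : ℝ) :
    (a • ContinuousLinearMap.id ℝ F - b • A).IsSymmetric :=
  (LinearMap.IsSymmetric.id.smul rfl).sub (hA.smul rfl)

theorem opNorm_le_of_abs_inner_le {c : ℝ} (hA : A.IsSymmetric) (hc0 : 0 ≤ c)
    (hc : ∀ u, |inner ℝ (A u) u| ≤ c * ‖u‖ ^ 2) : ‖A‖ ≤ c := by
  rw [A.norm_eq_iSup_rayleighQuotient hA]
  refine ciSup_le fun u => ?_
  rw [ContinuousLinearMap.rayleighQuotient, abs_div, abs_sq]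
  exact div_le_of_le_mul₀ (sq_nonneg _) hc0 (hc u)

end Recurrence

section Rate

variable {L μ : ℝ}

/-- The asymptotic convergence rate `(√L - √μ) / (√L + √μ)` of the heavy-ball method for a quadratic
with Hessian between `μ` and `L`. -/
def heavyBallRate (L μ : ℝ) : ℝ := (√L - √μ) / (√L + √μ)

theorem heavyBallRate_nonneg (hμL : μ ≤ L) : 0 ≤ heavyBallRate L μ :=
  div_nonneg (sub_nonneg.2 (Real.sqrt_le_sqrt hμL)) (by positivity)

theorem heavyBallRate_eq (hμ : 0 < μ) (hμL : μ ≤ L) :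
    heavyBallRate L μ = 1 - 2 / (√(L / μ) + 1) := by
  have : 0 < √μ := Real.sqrt_pos.2 hμ
  rw [heavyBallRate, Real.sqrt_div (hμ.le.trans hμL)]
  field_simp
  ring

theorem heavyBallRate_le_one (hμ : 0 < μ) (hμL : μ ≤ L) : heavyBallRate L μ ≤ 1 := by
  rw [heavyBallRate_eq hμ hμL]
  exact sub_le_self 1 (by positivity)

theorem sqrt_heavyBallStep_mul {s a : ℝ} (hs : 0 ≤ s) : √(4 / s ^ 2 * a) = 2 * √a / s := by
  rw [Real.sqrt_mul (by positivity), Real.sqrt_div (by norm_num), Real.sqrt_sq hs,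
    show (4 : ℝ) = 2 ^ 2 by norm_num, Real.sqrt_sq zero_le_two, div_mul_eq_mul_div]

theorem one_sub_sqrt_heavyBallStep_mul_left (hμ : 0 < μ) :
    1 - √(4 / (√L + √μ) ^ 2 * μ) = heavyBallRate L μ := by
  have : 0 < √μ := Real.sqrt_pos.2 hμ
  rw [sqrt_heavyBallStep_mul (by positivity), heavyBallRate]
  field_simp
  ring

theorem one_sub_sqrt_heavyBallStep_mul_right (hμ : 0 < μ) :
    1 - √(4 / (√L + √μ) ^ 2 * L) = -heavyBallRate L μ := by
  have : 0 < √μ := Real.sqrt_pos.2 hμ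
  rw [sqrt_heavyBallStep_mul (by positivity), heavyBallRate]
  field_simp
  ring

theorem heavyBallRate_pow_mul_le (hμ : 0 < μ) (hμL : μ ≤ L) (n : ℕ) :
    (2 * n + 1) * heavyBallRate L μ ^ n
      ≤ 2 * (√(L / μ) + 1) * Real.exp (-(n / (√(L / μ) + 1))) := by
  have hrate : heavyBallRate L μ ^ n
      ≤ Real.exp (-(n / (√(L / μ) + 1))) * Real.exp (-(n / (√(L / μ) + 1))) := by
    rw [heavyBallRate_eq hμ hμL, ← Real.exp_add]
    refine (one_sub_pow_le_exp ?_ n).trans_eq (by congr 1; ring)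
    rw [div_le_one (by positivity)]
    linarith [one_le_sqrt_div hμ hμL]
  set k := √(L / μ) + 1 with hk
  have hone : 1 ≤ k := by simp [hk]
  have hlinear : (2 * n + 1) * Real.exp (-(n / k)) ≤ 2 * k := by
    rw [Real.exp_neg, ← div_eq_mul_inv, div_le_iff₀ (Real.exp_pos _)]
    calc (2 * n + 1 : ℝ) ≤ 2 * k * (n / k + 1) := by field_simp; linarith
      _ ≤ _ := by gcongr; exact Real.add_one_le_exp _
  calc (2 * n + 1) * heavyBallRate L μ ^ n
      ≤ (2 * n + 1) * (Real.exp (-(n / k)) * Real.exp (-(n / k))) := by gcongr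
    _ = (2 * n + 1) * Real.exp (-(n / k)) * Real.exp (-(n / k)) := by ring
    _ ≤ _ := by gcongr

end Rate

variable {q : ℕ} {L μ : ℝ} {H : E q →L[ℝ] E q}

theorem iterate_hbStep_nH (lam θ : ℝ) (H : E q →L[ℝ] E q) (b : E q) (n : ℕ) (S : HBState q) :
    ((hbStep lam θ H b)^[n] S).nH = S.nH + n := by
  induction n with
  | zero => rfl
  | succ n ih => rw [Function.iterate_succ_apply', hbStep, ih, add_assoc]

theorem norm_iterate_hbStep_sub_le {lam r : ℝ} (hr0 : 0 ≤ r) (hr1 : r ≤ 1) (hH : H.IsSymmetric)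
    (hnorm : ‖(1 + r ^ 2) • ContinuousLinearMap.id ℝ (E q) - lam • H‖ ≤ 2 * r) (vs : E q) (n : ℕ) :
    ‖((hbStep lam (r ^ 2) H (H vs))^[n] ⟨0, 0, 0⟩).v - vs‖ ≤ (2 * n + 1) * r ^ n * ‖vs‖ := by
  let S : ℕ → HBState q := fun n => (hbStep lam (r ^ 2) H (H vs))^[n] ⟨0, 0, 0⟩
  have hS : ∀ n, S (n + 1) = hbStep lam (r ^ 2) H (H vs) (S n) := fun n =>
    Function.iterate_succ_apply' _ _ _
  have hprev : ∀ n, (S (n + 1)).vPrev = (S n).v := fun n => by rw [hS, hbStep]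
  have hbound := norm_le_of_heavyBall_recurrence (isSymmetric_smul_id_sub_smul hH _ _) hnorm hr0 hr1
    (u := fun n => (S n).vPrev - vs) (by simp [S, hbStep]) (fun n => ?_) n
  · simpa only [hprev, S, Function.iterate_zero, id, zero_sub, norm_neg] using hbound
  · simp only [hprev, hS (n := n), hbStep, sub_apply, smul_apply,
      ContinuousLinearMap.id_apply, map_sub]
    module

theorem opNorm_heavyBall_le (hμ : 0 < μ) (hμL : μ ≤ L) (hH : H.IsSymmetric)
    (hHμ : ∀ u, μ * ‖u‖ ^ 2 ≤ inner ℝ (H u) u) (hHL : ∀ u, inner ℝ (H u) u ≤ L * ‖u‖ ^ 2) :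
    ‖(1 + heavyBallRate L μ ^ 2) • ContinuousLinearMap.id ℝ (E q) - (4 / (√L + √μ) ^ 2) • H‖
      ≤ 2 * heavyBallRate L μ := by
  set r := heavyBallRate L μ with hr
  set lam := 4 / (√L + √μ) ^ 2
  have hlam : 0 ≤ lam := by positivity
  have hleft : lam * μ = (1 - r) ^ 2 := by
    rw [hr, ← one_sub_sqrt_heavyBallStep_mul_left hμ, sub_sub_cancel, Real.sq_sqrt (by positivity)]
  have hright : lam * L = (1 + r) ^ 2 := by
    have hL : 0 ≤ L := hμ.le.trans hμL
    rw [hr, ← sub_neg_eq_add, ← one_sub_sqrt_heavyBallStep_mul_right hμ, sub_sub_cancel,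
      Real.sq_sqrt (by positivity)]
  refine opNorm_le_of_abs_inner_le (isSymmetric_smul_id_sub_smul hH _ _)
    (mul_nonneg zero_le_two (heavyBallRate_nonneg hμL)) fun u => ?_
  have hlower := mul_le_mul_of_nonneg_left (hHμ u) hlam
  have hupper := mul_le_mul_of_nonneg_left (hHL u) hlam
  have hexpand : inner ℝ (((1 + r ^ 2) • ContinuousLinearMap.id ℝ (E q) - lam • H) u) u
      = (1 + r ^ 2) * ‖u‖ ^ 2 - lam * inner ℝ (H u) u := by
    simp [inner_sub_left, real_inner_smul_left]
  rw [hexpand, abs_le]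
  constructor
  · linear_combination hupper + ‖u‖ ^ 2 * hright
  · linear_combination hlower - ‖u‖ ^ 2 * hleft

theorem norm_iterate_hbStep_sub_le_exp (hμ : 0 < μ) (hμL : μ ≤ L) (hH : H.IsSymmetric)
    (hHμ : ∀ u, μ * ‖u‖ ^ 2 ≤ inner ℝ (H u) u) (hHL : ∀ u, inner ℝ (H u) u ≤ L * ‖u‖ ^ 2)
    (vs : E q) (n : ℕ) :
    ‖((hbStep (4 / (√L + √μ) ^ 2) (max ((1 - √(4 / (√L + √μ) ^ 2 * μ)) ^ 2)
        ((1 - √(4 / (√L + √μ) ^ 2 * L)) ^ 2)) H (H vs))^[n] ⟨0, 0, 0⟩).v - vs‖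
      ≤ 2 * (√(L / μ) + 1) * Real.exp (-(n / (√(L / μ) + 1))) * ‖vs‖ := by
  rw [one_sub_sqrt_heavyBallStep_mul_left hμ, one_sub_sqrt_heavyBallStep_mul_right hμ, neg_sq,
    max_self]
  refine (norm_iterate_hbStep_sub_le (heavyBallRate_nonneg hμL) (heavyBallRate_le_one hμ hμL) hH
    (opNorm_heavyBall_le hμ hμL hH hHμ hHL) vs n).trans ?_
  exact mul_le_mul_of_nonneg_right (heavyBallRate_pow_mul_le hμ hμL n) (norm_nonneg vs)

end HeavyBall

section PartialDerivatives

variable {X Y Z : Type*} [NormedAddCommGroup X] [NormedSpace ℝ X] [NormedAddCommGroup Y]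
  [NormedSpace ℝ Y] [NormedAddCommGroup Z] [NormedSpace ℝ Z] {F : X × Y → Z} {x : X} {y : Y}

theorem hasFDerivAt_coprod_partial (hF : DifferentiableAt ℝ F (x, y)) :
    HasFDerivAt F ((fderiv ℝ (fun x' => F (x', y)) x).coprod (fderiv ℝ (fun y' => F (x, y')) y))
      (x, y) := by
  have hfst : HasFDerivAt (fun x' => F (x', y)) _ x :=
    hF.hasFDerivAt.comp x (hasFDerivAt_prodMk_left x y)
  have hsnd : HasFDerivAt (fun y' => F (x, y')) _ y :=
    hF.hasFDerivAt.comp y (hasFDerivAt_prodMk_right x y)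
  rw [hfst.fderiv, hsnd.fderiv]
  refine hF.hasFDerivAt.congr_fderiv ?_
  ext <;> simp

theorem hasFDerivAt_along_lipschitz_curve {s : X → Y} {T : X →L[ℝ] Z}
    (hF : HasFDerivAt F (T.comp (ContinuousLinearMap.fst ℝ X Y)) (x, s x))
    (hs : (fun x' => s x' - s x) =O[𝓝 x] fun x' => x' - x) :
    HasFDerivAt (fun x' => F (x', s x')) T x := by
  have hgraph : (fun x' => (x', s x') - (x, s x)) =O[𝓝 x] fun x' => x' - x :=
    (isBigO_refl _ _).prod_left hs
  have hcont : Tendsto (fun x' => (x', s x')) (𝓝 x) (𝓝 (x, s x)) := by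
    rw [← tendsto_sub_nhds_zero_iff]
    exact hgraph.trans_tendsto (tendsto_sub_nhds_zero_iff.2 tendsto_id)
  exact .of_isLittleO ((hF.isLittleO.comp_tendsto hcont).trans_isBigO hgraph)

variable {p q : ℕ} {f : E p → E q → ℝ}

theorem hasGradientAt_gradX (hf : ContDiff ℝ 1 fun w : E p × E q => f w.1 w.2) (x : E p)
    (y : E q) : HasGradientAt (fun x' => f x' y) (gradX f x y) x :=
  ((hf.comp (contDiff_prodMk_left y)).differentiable one_ne_zero x).hasGradientAt

theorem hasGradientAt_gradY (hf : ContDiff ℝ 1 fun w : E p × E q => f w.1 w.2) (x : E p)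
    (y : E q) : HasGradientAt (f x) (gradY f x y) y :=
  ((hf.comp (contDiff_prodMk_right x)).differentiable one_ne_zero y).hasGradientAt

theorem hasFDerivAt_uncurry (hf : ContDiff ℝ 1 fun w : E p × E q => f w.1 w.2) (x : E p)
    (y : E q) : HasFDerivAt (fun w : E p × E q => f w.1 w.2)
      ((innerSL ℝ (gradX f x y)).coprod (innerSL ℝ (gradY f x y))) (x, y) := by
  have hpartial := hasFDerivAt_coprod_partial (hf.differentiable one_ne_zero (x, y))
  rwa [(hasGradientAt_gradX hf x y).hasFDerivAt.fderiv,
    (hasGradientAt_gradY hf x y).hasFDerivAt.fderiv] at hpartial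

end PartialDerivatives

section Hypergradient

variable {p q : ℕ} {Lx Lxy Ly Lgxy Lgy ρxy ρyy μx μy U : ℝ} {f g : E p → E q → ℝ}

/-- The solution `v = ∇²_y g(x, y)⁻¹ ∇_y f(x, y)` of the linear system that the heavy-ball loop
approximates. -/
def linearSol (f g : E p → E q → ℝ) (x : E p) (y : E q) : E q :=
  (hessY g x y).inverse (gradY f x y)

/-- The hypergradient formula `∇ₓ f(x, y) - ∇ₓ∇_y g(x, y) v`, which is `∇Φ(x)` when `y = y*(x)` and
`v` solves the linear system there. -/
def hypergrad (f g : E p → E q → ℝ) (x : E p) (y v : E q) : E p :=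
  gradX f x y - jacXY g x y v

namespace IsSCSC

section LowerLevel

variable (h : IsSCSC Lx Lxy Ly Lgxy Lgy ρxy ρyy μx μy f g)
include h

theorem quadraticLowerBound (x : E p) : QuadraticLowerBound μy (g x) (gradY g x) :=
  quadraticLowerBound_of_strongConvexOn (h.g_strongConvex x) (hasGradientAt_gradY h.g_contDiff x)

theorem quadraticUpperBound (x : E p) : QuadraticUpperBound Lgy (g x) (gradY g x) :=
  quadraticUpperBound_of_lipschitz_gradient (hasGradientAt_gradY h.g_contDiff x)
    (h.gradY_g_lip_y x)

theorem μy_le_Lgy (hq : 1 ≤ q) : μy ≤ Lgy := by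
  have : Nonempty (Fin q) := ⟨⟨0, hq⟩⟩
  obtain ⟨u, hu⟩ := exists_ne (0 : E q)
  exact le_of_mul_le_mul_right
    (((h.quadraticLowerBound 0).mul_norm_sub_le u 0).trans (h.gradY_g_lip_y 0 u 0))
    (norm_pos_iff.2 (sub_ne_zero.2 hu))

theorem isMinOn_lowerSol (hμy : 0 < μy) (x : E p) : IsMinOn (g x) Set.univ (lowerSol g x) :=
  Classical.epsilon_spec ((h.quadraticLowerBound x).exists_isMinOn hμy
    (h.g_contDiff.comp (contDiff_prodMk_right x)).continuous)

theorem gradY_lowerSol (hμy : 0 < μy) (x : E p) : gradY g x (lowerSol g x) = 0 := by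
  have hcrit := ((h.isMinOn_lowerSol hμy x).isLocalMin univ_mem).hasFDerivAt_eq_zero
    (hasGradientAt_gradY h.g_contDiff x _).hasFDerivAt
  simpa using hcrit

theorem norm_lowerSol_sub_le (hμy : 0 < μy) (x₁ x₂ : E p) :
    ‖lowerSol g x₁ - lowerSol g x₂‖ ≤ Lgxy / μy * ‖x₁ - x₂‖ := by
  have hmono := (h.quadraticLowerBound x₁).mul_norm_sub_le (lowerSol g x₁) (lowerSol g x₂)
  have hlip := h.gradY_g_lip_x x₁ x₂ (lowerSol g x₂)
  rw [h.gradY_lowerSol hμy, zero_sub, norm_neg] at hmono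
  rw [h.gradY_lowerSol hμy, sub_zero] at hlip
  rw [div_mul_eq_mul_div, le_div_iff₀' hμy]
  exact hmono.trans hlip

theorem hasFDerivAt_gradY (x : E p) (y : E q) : HasFDerivAt (gradY g x) (hessY g x y) y :=
  ((h.gradY_g_contDiff.comp (contDiff_prodMk_right x)).differentiable one_ne_zero y).hasFDerivAt

theorem isSymmetric_hessY (x : E p) (y : E q) : (hessY g x y : E q →ₗ[ℝ] E q).IsSymmetric := by
  intro u v
  have hsymm := second_derivative_symmetric (f' := fun y' => innerSL ℝ (gradY g x y'))
    (fun y' => (hasGradientAt_gradY h.g_contDiff x y').hasFDerivAt)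
    ((innerSL ℝ).hasFDerivAt.comp y (h.hasFDerivAt_gradY x y)) u v
  exact hsymm.trans (real_inner_comm u (hessY g x y v))

theorem mul_norm_sq_le_inner_hessY (x : E p) (y u : E q) :
    μy * ‖u‖ ^ 2 ≤ inner ℝ (hessY g x y u) u :=
  mul_norm_sq_le_inner_of_hasFDerivAt (h.hasFDerivAt_gradY x y)
    (h.quadraticLowerBound x).mul_norm_sub_sq_le_inner u

theorem inner_hessY_le (x : E p) (y u : E q) :
    inner ℝ (hessY g x y u) u ≤ Lgy * ‖u‖ ^ 2 := by
  have hneg := mul_norm_sq_le_inner_of_hasFDerivAt (μ := -Lgy) (h.hasFDerivAt_gradY x y).neg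
    (fun y₁ y₂ => by
      have hcs := real_inner_le_norm (gradY g x y₁ - gradY g x y₂) (y₁ - y₂)
      have hlip := mul_le_mul_of_nonneg_right (h.gradY_g_lip_y x y₁ y₂) (norm_nonneg (y₁ - y₂))
      rw [Pi.neg_apply, Pi.neg_apply, ← neg_sub', inner_neg_left]
      linarith) u
  rw [_root_.neg_apply, inner_neg_left] at hneg
  linarith

theorem mul_norm_le_norm_hessY (x : E p) (y u : E q) : μy * ‖u‖ ≤ ‖hessY g x y u‖ :=
  mul_norm_le_norm_of_mul_norm_sq_le_inner (h.mul_norm_sq_le_inner_hessY x y u)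

theorem norm_jacXY_le (hLgxy : 0 ≤ Lgxy) (x : E p) (y : E q) : ‖jacXY g x y‖ ≤ Lgxy := by
  rw [jacXY, LinearIsometryEquiv.norm_map]
  refine norm_fderiv_le_of_lipschitz ℝ (C := ⟨Lgxy, hLgxy⟩) ?_
  refine LipschitzWith.of_dist_le_mul fun x₁ x₂ => ?_
  rw [dist_eq_norm, dist_eq_norm]
  exact h.gradY_g_lip_x x₁ x₂ y

theorem hessY_linearSol (hμy : 0 < μy) (x : E p) (y : E q) :
    hessY g x y (linearSol f g x y) = gradY f x y := by
  have hinj : Function.Injective (hessY g x y : E q →ₗ[ℝ] E q) := by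
    refine (injective_iff_map_eq_zero _).2 fun u hu => norm_le_zero_iff.1 ?_
    have hle := h.mul_norm_le_norm_hessY x y u
    rw [show hessY g x y u = 0 from hu, norm_zero] at hle
    exact nonpos_of_mul_nonpos_right hle hμy
  have hinv : (hessY g x y).IsInvertible :=
    ⟨(LinearEquiv.ofInjectiveEndo _ hinj).toContinuousLinearEquiv, by ext; rfl⟩
  exact hinv.self_apply_inverse _

theorem norm_linearSol_le (hμy : 0 < μy) (hU : ∀ x y, ‖gradY f x y‖ ≤ U) (x : E p) (y : E q) :
    ‖linearSol f g x y‖ ≤ U / μy := by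
  rw [le_div_iff₀' hμy]
  refine (h.mul_norm_le_norm_hessY x y _).trans ?_
  rw [h.hessY_linearSol hμy]
  exact hU x y

theorem norm_linearSol_sub_le (hμy : 0 < μy) (hU : ∀ x y, ‖gradY f x y‖ ≤ U) (x₁ x₂ : E p)
    (y₁ y₂ : E q) :
    ‖linearSol f g x₁ y₁ - linearSol f g x₂ y₂‖
      ≤ (Lxy * ‖x₁ - x₂‖ + Ly * ‖y₁ - y₂‖
        + ρyy * √(‖x₁ - x₂‖ ^ 2 + ‖y₁ - y₂‖ ^ 2) * (U / μy)) / μy := by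
  have hsplit : hessY g x₁ y₁ (linearSol f g x₁ y₁ - linearSol f g x₂ y₂)
      = (gradY f x₁ y₁ - gradY f x₂ y₁) + (gradY f x₂ y₁ - gradY f x₂ y₂)
        - (hessY g x₁ y₁ - hessY g x₂ y₂) (linearSol f g x₂ y₂) := by
    rw [map_sub, _root_.sub_apply, h.hessY_linearSol hμy, h.hessY_linearSol hμy]
    abel
  have hhess := h.hessY_g_lip x₁ y₁ x₂ y₂
  rw [le_div_iff₀' hμy]
  calc μy * ‖linearSol f g x₁ y₁ - linearSol f g x₂ y₂‖
      ≤ ‖hessY g x₁ y₁ (linearSol f g x₁ y₁ - linearSol f g x₂ y₂)‖ :=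
        h.mul_norm_le_norm_hessY x₁ y₁ _
    _ ≤ ‖gradY f x₁ y₁ - gradY f x₂ y₁‖ + ‖gradY f x₂ y₁ - gradY f x₂ y₂‖
        + ‖hessY g x₁ y₁ - hessY g x₂ y₂‖ * ‖linearSol f g x₂ y₂‖ := by
      rw [hsplit]
      exact (norm_sub_le _ _).trans
        (add_le_add (norm_add_le _ _) (ContinuousLinearMap.le_opNorm _ _))
    _ ≤ _ := add_le_add (add_le_add (h.gradY_f_lip_x x₁ x₂ y₁) (h.gradY_f_lip_y x₂ y₁ y₂))
        (mul_le_mul hhess (h.norm_linearSol_le hμy hU x₂ y₂) (norm_nonneg _)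
          ((norm_nonneg _).trans hhess))

end LowerLevel

section Hypergradient

variable (h : IsSCSC Lx Lxy Ly Lgxy Lgy ρxy ρyy μx μy f g)
include h

theorem norm_hypergrad_sub_le (hLgxy : 0 ≤ Lgxy) (x : E p) (y v₁ v₂ : E q) :
    ‖hypergrad f g x y v₁ - hypergrad f g x y v₂‖ ≤ Lgxy * ‖v₁ - v₂‖ := by
  rw [hypergrad, hypergrad, sub_sub_sub_cancel_left, ← map_sub, norm_sub_rev v₁]
  exact ContinuousLinearMap.le_of_opNorm_le _ (h.norm_jacXY_le hLgxy x y) _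

theorem norm_hypergrad_linearSol_sub_le (hμy : 0 < μy) (hLgxy : 0 ≤ Lgxy)
    (hU : ∀ x y, ‖gradY f x y‖ ≤ U) (x₁ x₂ : E p) (y₁ y₂ : E q) :
    ‖hypergrad f g x₁ y₁ (linearSol f g x₁ y₁) - hypergrad f g x₂ y₂ (linearSol f g x₂ y₂)‖
      ≤ (Lx + Lgxy * Lxy / μy) * ‖x₁ - x₂‖ + (Lxy + Lgxy * Ly / μy) * ‖y₁ - y₂‖
        + (U * ρxy / μy + U * Lgxy * ρyy / μy ^ 2) * √(‖x₁ - x₂‖ ^ 2 + ‖y₁ - y₂‖ ^ 2) := by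
  set v₁ := linearSol f g x₁ y₁
  set v₂ := linearSol f g x₂ y₂
  have hsplit : hypergrad f g x₁ y₁ v₁ - hypergrad f g x₂ y₂ v₂
      = (gradX f x₁ y₁ - gradX f x₂ y₁) + (gradX f x₂ y₁ - gradX f x₂ y₂)
        + (hypergrad f g x₁ y₁ v₁ - hypergrad f g x₁ y₁ v₂)
        - (jacXY g x₁ y₁ - jacXY g x₂ y₂) v₂ := by
    simp only [hypergrad, _root_.sub_apply]
    abel
  have hjac := h.jacXY_g_lip x₁ y₁ x₂ y₂
  have hsol : ‖hypergrad f g x₁ y₁ v₁ - hypergrad f g x₁ y₁ v₂‖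
      ≤ Lgxy * ((Lxy * ‖x₁ - x₂‖ + Ly * ‖y₁ - y₂‖
        + ρyy * √(‖x₁ - x₂‖ ^ 2 + ‖y₁ - y₂‖ ^ 2) * (U / μy)) / μy) :=
    (h.norm_hypergrad_sub_le hLgxy x₁ y₁ v₁ v₂).trans
      (mul_le_mul_of_nonneg_left (h.norm_linearSol_sub_le hμy hU x₁ x₂ y₁ y₂) hLgxy)
  calc ‖hypergrad f g x₁ y₁ v₁ - hypergrad f g x₂ y₂ v₂‖
      ≤ ‖gradX f x₁ y₁ - gradX f x₂ y₁‖ + ‖gradX f x₂ y₁ - gradX f x₂ y₂‖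
        + ‖hypergrad f g x₁ y₁ v₁ - hypergrad f g x₁ y₁ v₂‖
        + ‖jacXY g x₁ y₁ - jacXY g x₂ y₂‖ * ‖v₂‖ := by
        rw [hsplit]
        exact (norm_sub_le _ _).trans (add_le_add norm_add₃_le (ContinuousLinearMap.le_opNorm _ _))
    _ ≤ _ := add_le_add
        (add_le_add (add_le_add (h.gradX_f_lip_x x₁ x₂ y₁) (h.gradX_f_lip_y x₂ y₁ y₂)) hsol)
        (mul_le_mul hjac (h.norm_linearSol_le hμy hU x₂ y₂) (norm_nonneg _)
          ((norm_nonneg _).trans hjac))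
    _ = _ := by
      field_simp
      ring

-- The Lagrangian `f - ⟪v, ∇_y g⟫` with multiplier `v` has no first-order dependence on `y` at
-- `(x, y*(x))`, and it equals `Φ` along `y*`; so the mere Lipschitz continuity of `y*` suffices.
theorem hasGradientAt_objective (hμy : 0 < μy) (x : E p) :
    HasGradientAt (objective f g)
      (hypergrad f g x (lowerSol g x) (linearSol f g x (lowerSol g x))) x := by
  set y := lowerSol g x
  set v := linearSol f g x y
  have hgrad := hasFDerivAt_coprod_partial (h.gradY_g_contDiff.differentiable one_ne_zero (x, y))
  have hlagrangian : HasFDerivAt (fun w : E p × E q => f w.1 w.2 - inner ℝ v (gradY g w.1 w.2))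
      ((innerSL ℝ (hypergrad f g x y v)).comp (ContinuousLinearMap.fst ℝ _ _)) (x, y) := by
    refine ((hasFDerivAt_uncurry h.f_contDiff x y).sub
      ((innerSL ℝ v).hasFDerivAt.comp (x, y) hgrad)).congr_fderiv ?_
    ext a
    · simp [hypergrad, jacXY, ContinuousLinearMap.adjoint_inner_left]
    · have hHv : inner ℝ (gradY f x y) a = inner ℝ v (hessY g x y a) := by
        rw [← h.hessY_linearSol hμy]
        exact h.isSymmetric_hessY x y v a
      simpa [sub_eq_zero] using! hHv
  have hlip : (fun x' => lowerSol g x' - lowerSol g x) =O[𝓝 x] fun x' => x' - x :=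
    .of_bound (Lgxy / μy) (Eventually.of_forall fun x' => h.norm_lowerSol_sub_le hμy x' x)
  have henvelope := hasFDerivAt_along_lipschitz_curve hlagrangian hlip
  simp only [h.gradY_lowerSol hμy, inner_zero_right, sub_zero] at henvelope
  exact henvelope

theorem gradient_objective (hμy : 0 < μy) (x : E p) :
    gradient (objective f g) x
      = hypergrad f g x (lowerSol g x) (linearSol f g x (lowerSol g x)) :=
  (h.hasGradientAt_objective hμy x).gradient

theorem differentiable_objective (hμy : 0 < μy) : Differentiable ℝ (objective f g) :=
  fun x => (h.hasGradientAt_objective hμy x).differentiableAt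

theorem norm_hypergrad_linearSol_sub_gradient_le (hμy : 0 < μy) (hLgxy : 0 ≤ Lgxy)
    (hU : ∀ x y, ‖gradY f x y‖ ≤ U) (x : E p) (y : E q) :
    ‖hypergrad f g x y (linearSol f g x y) - gradient (objective f g) x‖
      ≤ (Lxy + Lgxy * Ly / μy + (U * ρxy / μy + U * Lgxy * ρyy / μy ^ 2)) * ‖y - lowerSol g x‖ := by
  have hlip := h.norm_hypergrad_linearSol_sub_le hμy hLgxy hU x x y (lowerSol g x)
  rw [sub_self x, norm_zero, zero_pow two_ne_zero, zero_add, Real.sqrt_sq (norm_nonneg _)] at hlip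
  rw [h.gradient_objective hμy]
  linarith

theorem norm_gradient_objective_sub_le (hμy : 0 < μy) (hLxy : 0 ≤ Lxy) (hLy : 0 ≤ Ly)
    (hLgxy : 0 ≤ Lgxy) (hρxy : 0 ≤ ρxy) (hρyy : 0 ≤ ρyy) (hU : ∀ x y, ‖gradY f x y‖ ≤ U)
    (x₁ x₂ : E p) :
    ‖gradient (objective f g) x₁ - gradient (objective f g) x₂‖
      ≤ smoothPhi Lx Lxy Ly Lgxy ρxy ρyy U μy * ‖x₁ - x₂‖ := by
  have hU0 : 0 ≤ U := (norm_nonneg _).trans (hU 0 0)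
  have hsol := h.norm_lowerSol_sub_le hμy x₁ x₂
  have hdist : √(‖x₁ - x₂‖ ^ 2 + ‖lowerSol g x₁ - lowerSol g x₂‖ ^ 2)
      ≤ ‖x₁ - x₂‖ + Lgxy / μy * ‖x₁ - x₂‖ := by
    refine Real.sqrt_le_iff.2 ⟨by positivity, ?_⟩
    nlinarith [norm_nonneg (x₁ - x₂), norm_nonneg (lowerSol g x₁ - lowerSol g x₂),
      mul_nonneg (norm_nonneg (x₁ - x₂)) ((norm_nonneg _).trans hsol)]
  rw [h.gradient_objective hμy, h.gradient_objective hμy]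
  refine (h.norm_hypergrad_linearSol_sub_le hμy hLgxy hU x₁ x₂ _ _).trans ?_
  calc _ ≤ (Lx + Lgxy * Lxy / μy) * ‖x₁ - x₂‖
        + (Lxy + Lgxy * Ly / μy) * (Lgxy / μy * ‖x₁ - x₂‖)
        + (U * ρxy / μy + U * Lgxy * ρyy / μy ^ 2) * (‖x₁ - x₂‖ + Lgxy / μy * ‖x₁ - x₂‖) := by
        gcongr
    _ = _ := by
      rw [smoothPhi]
      field_simp
      ring

theorem quadraticLowerBound_objective (hμy : 0 < μy) :
    QuadraticLowerBound μx (objective f g) (gradient (objective f g)) :=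
  quadraticLowerBound_of_strongConvexOn h.objective_strongConvex
    fun x => (h.differentiable_objective hμy x).hasGradientAt

theorem quadraticUpperBound_objective (hμy : 0 < μy) (hLxy : 0 ≤ Lxy) (hLy : 0 ≤ Ly)
    (hLgxy : 0 ≤ Lgxy) (hρxy : 0 ≤ ρxy) (hρyy : 0 ≤ ρyy) (hU : ∀ x y, ‖gradY f x y‖ ≤ U) :
    QuadraticUpperBound (smoothPhi Lx Lxy Ly Lgxy ρxy ρyy U μy) (objective f g)
      (gradient (objective f g)) :=
  quadraticUpperBound_of_lipschitz_gradient
    (fun x => (h.differentiable_objective hμy x).hasGradientAt)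
    (h.norm_gradient_objective_sub_le hμy hLxy hLy hLgxy hρxy hρyy hU)

theorem μx_le_smoothPhi (hμy : 0 < μy) (hLxy : 0 ≤ Lxy) (hLy : 0 ≤ Ly) (hLgxy : 0 ≤ Lgxy)
    (hρxy : 0 ≤ ρxy) (hρyy : 0 ≤ ρyy) (hU : ∀ x y, ‖gradY f x y‖ ≤ U) :
    μx ≤ smoothPhi Lx Lxy Ly Lgxy ρxy ρyy U μy := by
  obtain ⟨xs, -, B, hB, hxs⟩ := h.exists_min
  have hlip := h.norm_gradient_objective_sub_le hμy hLxy hLy hLgxy hρxy hρyy hU xs 0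
  have hmono := (h.quadraticLowerBound_objective hμy).mul_norm_sub_le xs 0
  rw [sub_zero, hxs] at hlip hmono
  exact le_of_mul_le_mul_right (hmono.trans hlip) hB

end Hypergradient

end IsSCSC

end Hypergradient

section OuterLoop

theorem le_pow_mul_add_of_le_mul_add {W : ℕ → ℝ} {ρ w : ℝ} (hρ : 0 ≤ ρ) (hw : 0 ≤ w)
    (hstep : ∀ k, W (k + 1) ≤ ρ * W k + (1 - ρ) * w) (K : ℕ) : W K ≤ ρ ^ K * W 0 + w := by
  have hgeom := le_geom (u := fun k => W k - w) hρ K fun k _ => by linarith [hstep k]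
  have hdrop : 0 ≤ ρ ^ K * w := by positivity
  linarith

theorem coupled_lyapunov_step {V V' c₁ c₂ e h δ s d d' l X A τ b : ℝ} (hτ : τ ≤ 1) (hc₂ : 0 ≤ c₂)
    (he : 0 ≤ e) (hd' : 0 ≤ d') (hA : 0 ≤ A) (hV : V' ≤ (1 - τ / 2) * V + c₂ * e ^ 2 - b * X ^ 2)
    (heδ : e ≤ c₁ * δ + h) (hδ : δ ^ 2 ≤ s * (d + l * X) ^ 2) (hdδ : d' ≤ δ + l * X)
    (hAl : 5 / 2 * (A * l ^ 2) ≤ b) (hs : 8 * (c₂ * c₁ ^ 2 + A) * s ≤ A) :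
    V' + A * d' ^ 2 ≤ (1 - τ / 2) * (V + A * d ^ 2) + 2 * c₂ * h ^ 2 := by
  have herror : c₂ * e ^ 2 ≤ c₂ * (2 * c₁ ^ 2 * δ ^ 2 + 2 * h ^ 2) := by
    refine mul_le_mul_of_nonneg_left ((pow_le_pow_left₀ he heδ 2).trans ?_) hc₂
    linarith [sq_nonneg (c₁ * δ - h)]
  have hdrift : A * d' ^ 2 ≤ A * (2 * δ ^ 2 + 2 * (l ^ 2 * X ^ 2)) := by
    refine mul_le_mul_of_nonneg_left ((pow_le_pow_left₀ hd' hdδ 2).trans ?_) hA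
    linarith [sq_nonneg (δ - l * X)]
  have hinner : 2 * (c₂ * c₁ ^ 2 + A) * δ ^ 2 ≤ A / 2 * (d ^ 2 + l ^ 2 * X ^ 2) :=
    calc 2 * (c₂ * c₁ ^ 2 + A) * δ ^ 2
        ≤ 2 * (c₂ * c₁ ^ 2 + A) * (s * (d + l * X) ^ 2) := by gcongr
      _ = 8 * (c₂ * c₁ ^ 2 + A) * s * ((d + l * X) ^ 2 / 4) := by ring
      _ ≤ A * ((d + l * X) ^ 2 / 4) := by gcongr
      _ ≤ A * ((d ^ 2 + l ^ 2 * X ^ 2) / 2) := by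
        refine mul_le_mul_of_nonneg_left ?_ hA
        linarith [sq_nonneg (d - l * X)]
      _ = _ := by ring
  have hshift := mul_le_mul_of_nonneg_right hAl (sq_nonneg X)
  have hslack : 0 ≤ (1 - τ) * (A * d ^ 2) := mul_nonneg (by linarith) (by positivity)
  linarith

/-- The constants of the problem class together with the bound `U` for `‖∇_y f‖` and the outer
stepsize `α`, bundled so that the quantities derived from them can be named. -/
structure Constants where
  (Lx Lxy Ly Lgxy Lgy ρxy ρyy μx μy U α : ℝ)

namespace Constants

variable (P : Constants)

/-- The smoothness parameter `L_Φ`. -/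
def LΦ : ℝ := smoothPhi P.Lx P.Lxy P.Ly P.Lgxy P.ρxy P.ρyy P.U P.μy

/-- The lower-level condition number `κ_y = L̃_y / μ_y`. -/
def κ : ℝ := P.Lgy / P.μy

/-- The Lipschitz constant of `y*`. -/
def lowerLip : ℝ := P.Lgxy / P.μy

/-- The Lipschitz constant of `y ↦ hypergrad f g x y (linearSol f g x y)`. -/
def hyperLip : ℝ :=
  P.Lxy + P.Lgxy * P.Ly / P.μy + (P.U * P.ρxy / P.μy + P.U * P.Lgxy * P.ρyy / P.μy ^ 2)

/-- The momentum parameter `τ = √(α μₓ) / 2`; the other outer parameters are `η = τ / (τ + 1)`,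
`β = 2τ / μₓ` and `α = 4τ² / μₓ`. -/
def τ : ℝ := √(P.α * P.μx) / 2

/-- The weight of the warm-start error in the Lyapunov function, small enough for the drift of
`y*(x̃_k)` to be paid for by the strong convexity of `Φ`. -/
def warmWeight : ℝ := P.τ * P.μx / (20 * (1 + P.lowerLip ^ 2))

/-- The factor by which the lower-level solver has to reduce the squared warm-start error. -/
def warmRatio : ℝ := 8 * (60 * (P.hyperLip ^ 2 * (1 + P.lowerLip ^ 2)) / P.μx ^ 2 + 1)

/-- The part of the hypergradient error that is due to the `M - 1` heavy-ball steps. -/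
def hbError (M : ℕ) : ℝ :=
  P.Lgxy * (2 * (√P.κ + 1) * Real.exp (-((M - 1 : ℕ) / (√P.κ + 1))) * (P.U / P.μy))

/-- The parameters of AccBiO-BG with inner loops of lengths `N` and `M`. -/
def params (N M : ℕ) : Params := scscParams P.Lgy P.μx P.μy P.α N M

/-- The conditions on the constants under which AccBiO-BG is analysed. -/
structure IsAdmissible : Prop where
  Lxy_nonneg : 0 ≤ P.Lxy
  Ly_nonneg : 0 ≤ P.Ly
  Lgxy_nonneg : 0 ≤ P.Lgxy
  ρxy_nonneg : 0 ≤ P.ρxy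
  ρyy_nonneg : 0 ≤ P.ρyy
  U_nonneg : 0 ≤ P.U
  μx_pos : 0 < P.μx
  μy_pos : 0 < P.μy
  μy_le_Lgy : P.μy ≤ P.Lgy
  μx_le_LΦ : P.μx ≤ P.LΦ
  α_pos : 0 < P.α
  α_mul_LΦ_le : P.α * P.LΦ ≤ 1 / 2

/-- Membership of `(f, g)` in the problem class with the given constants. -/
structure InClass {p q : ℕ} (f g : E p → E q → ℝ) : Prop where
  isSCSC : IsSCSC P.Lx P.Lxy P.Ly P.Lgxy P.Lgy P.ρxy P.ρyy P.μx P.μy f g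
  norm_gradY_le : ∀ x y, ‖gradY f x y‖ ≤ P.U

theorem warmWeight_mul : 20 * (P.warmWeight * (1 + P.lowerLip ^ 2)) = P.τ * P.μx := by
  rw [warmWeight]
  field_simp

variable {P}

namespace IsAdmissible

variable (hP : P.IsAdmissible)
include hP

theorem one_le_κ : 1 ≤ P.κ := (one_le_div hP.μy_pos).2 hP.μy_le_Lgy

theorem τ_pos : 0 < P.τ := half_pos (Real.sqrt_pos.2 (mul_pos hP.α_pos hP.μx_pos))

theorem four_mul_τ_sq : 4 * P.τ ^ 2 = P.α * P.μx := by
  rw [τ, div_pow, Real.sq_sqrt (mul_pos hP.α_pos hP.μx_pos).le]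
  ring

theorem eight_mul_τ_sq_mul_LΦ_le : 8 * P.τ ^ 2 * P.LΦ ≤ P.μx := by
  have hscaled := mul_le_mul_of_nonneg_right hP.α_mul_LΦ_le hP.μx_pos.le
  linear_combination 2 * P.LΦ * hP.four_mul_τ_sq + 2 * hscaled

theorem τ_le_half : P.τ ≤ 1 / 2 := by
  have hsmooth := hP.eight_mul_τ_sq_mul_LΦ_le
  have hτμ : 8 * P.τ ^ 2 * P.μx ≤ 1 * P.μx := by
    rw [one_mul]
    exact (mul_le_mul_of_nonneg_left hP.μx_le_LΦ (by positivity)).trans hsmooth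
  exact le_of_sq_le_sq (by linarith [le_of_mul_le_mul_right hτμ hP.μx_pos]) (by norm_num)

theorem α_eq : P.α = 4 * P.τ ^ 2 / P.μx := by
  rw [hP.four_mul_τ_sq, mul_div_cancel_right₀ _ hP.μx_pos.ne']

theorem sqrt_α_div_μx : √(P.α / P.μx) = 2 * P.τ / P.μx := by
  rw [hP.α_eq, div_div, show 4 * P.τ ^ 2 / (P.μx * P.μx) = (2 * P.τ / P.μx) ^ 2 by ring,
    Real.sqrt_sq (div_nonneg (by linarith [hP.τ_pos]) hP.μx_pos.le)]

theorem warmWeight_pos : 0 < P.warmWeight :=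
  div_pos (mul_pos hP.τ_pos hP.μx_pos) (by positivity)

theorem warmWeight_mul_warmRatio :
    P.warmWeight * P.warmRatio = 8 * (3 * P.τ / P.μx * P.hyperLip ^ 2 + P.warmWeight) := by
  have hμx := hP.μx_pos.ne'
  rw [warmRatio, warmWeight]
  field_simp
  ring

end IsAdmissible

end Constants

variable {p q : ℕ} {f g : E p → E q → ℝ} {P : Constants}

/-- The extrapolated point `x̃_k = η x_k + (1 - η) z_k` of iteration `k`. -/
def extrapolation (Q : Params) (k : ℕ) (S : State p q) : E p :=
  Q.η k • S.x + (1 - Q.η k) • S.z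

/-- The approximate solution `v_k^M` of the linear system computed by the heavy-ball loop. -/
def hbSol (Q : Params) (f g : E p → E q → ℝ) (x : E p) (y : E q) : E q :=
  ((hbStep Q.lam Q.θ (hessY g x y) (gradY f x y))^[Q.M - 1] ⟨0, 0, 0⟩).v

/-- The joint Lyapunov function of the outer loop and of the lower-level warm start. -/
def lyapunov (P : Constants) (f g : E p → E q → ℝ) (xs : E p) (S : State p q) : ℝ :=
  accelPotential (P.μx / 2) (objective f g) xs S.x S.z
    + P.warmWeight * ‖S.y - lowerSol g xs‖ ^ 2

namespace Constants.InClass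

variable (h : P.InClass f g) (hP : P.IsAdmissible)
include h hP

theorem norm_lowerSol_sub_le (x₁ x₂ : E p) :
    ‖lowerSol g x₁ - lowerSol g x₂‖ ≤ P.lowerLip * ‖x₁ - x₂‖ :=
  h.isSCSC.norm_lowerSol_sub_le hP.μy_pos x₁ x₂

theorem norm_gradient_objective_sub_le (x₁ x₂ : E p) :
    ‖gradient (objective f g) x₁ - gradient (objective f g) x₂‖ ≤ P.LΦ * ‖x₁ - x₂‖ :=
  h.isSCSC.norm_gradient_objective_sub_le hP.μy_pos hP.Lxy_nonneg hP.Ly_nonneg hP.Lgxy_nonneg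
    hP.ρxy_nonneg hP.ρyy_nonneg h.norm_gradY_le x₁ x₂

theorem norm_hbSol_sub_le (N M : ℕ) (x : E p) (y : E q) :
    ‖hbSol (P.params N M) f g x y - linearSol f g x y‖
      ≤ 2 * (√P.κ + 1) * Real.exp (-((M - 1 : ℕ) / (√P.κ + 1))) * (P.U / P.μy) := by
  have hbound := norm_iterate_hbStep_sub_le_exp hP.μy_pos hP.μy_le_Lgy
    (h.isSCSC.isSymmetric_hessY x y) (h.isSCSC.mul_norm_sq_le_inner_hessY x y)
    (h.isSCSC.inner_hessY_le x y) (linearSol f g x y) (M - 1)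
  rw [h.isSCSC.hessY_linearSol hP.μy_pos] at hbound
  refine hbound.trans (mul_le_mul_of_nonneg_left ?_ (by positivity))
  exact h.isSCSC.norm_linearSol_le hP.μy_pos h.norm_gradY_le x y

theorem norm_hypergrad_hbSol_sub_gradient_le (N M : ℕ) (x : E p) (y : E q) :
    ‖hypergrad f g x y (hbSol (P.params N M) f g x y) - gradient (objective f g) x‖
      ≤ P.hyperLip * ‖y - lowerSol g x‖ + P.hbError M := by
  refine (norm_sub_le_norm_sub_add_norm_sub _ (hypergrad f g x y (linearSol f g x y)) _).trans ?_
  rw [add_comm]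
  exact add_le_add
    (h.isSCSC.norm_hypergrad_linearSol_sub_gradient_le hP.μy_pos hP.Lgxy_nonneg h.norm_gradY_le x y)
    ((h.isSCSC.norm_hypergrad_sub_le hP.Lgxy_nonneg x y _ _).trans
      (mul_le_mul_of_nonneg_left (h.norm_hbSol_sub_le hP N M x y) hP.Lgxy_nonneg))

theorem norm_inner_sub_sq_le (xs x : E p) (y₀ : E q) (N : ℕ) :
    ‖((agdStep P.Lgy P.κ (gradY g x))^[N] ⟨y₀, y₀, 0⟩).y - lowerSol g x‖ ^ 2
      ≤ (P.κ + 1) * Real.exp (-(N / √P.κ))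
        * (‖y₀ - lowerSol g xs‖ + P.lowerLip * ‖x - xs‖) ^ 2 := by
  have hκ := hP.one_le_κ
  refine (norm_iterate_agdStep_sub_sq_le hP.μy_pos hP.μy_le_Lgy (h.isSCSC.quadraticLowerBound x)
    (h.isSCSC.quadraticUpperBound x) (h.isSCSC.gradY_lowerSol hP.μy_pos x) y₀ N).trans ?_
  have hdist : ‖y₀ - lowerSol g x‖ ≤ ‖y₀ - lowerSol g xs‖ + P.lowerLip * ‖x - xs‖ := by
    rw [norm_sub_rev x]
    exact (norm_sub_le_norm_sub_add_norm_sub _ _ _).trans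
      (add_le_add_right (h.norm_lowerSol_sub_le hP xs x) _)
  exact mul_le_mul_of_nonneg_left (pow_le_pow_left₀ (norm_nonneg _) hdist 2) (by positivity)

theorem accelPotential_accBiOBGStep_le {xs : E p} (hxs : IsMinOn (objective f g) Set.univ xs)
    (N M k : ℕ) (S : State p q) :
    accelPotential (P.μx / 2) (objective f g) xs (accBiOBGStep (P.params N M) f g k S).x
        (accBiOBGStep (P.params N M) f g k S).z
      ≤ (1 - P.τ / 2) * accelPotential (P.μx / 2) (objective f g) xs S.x S.z
        + 3 * P.τ / P.μx * ‖hypergrad f g (extrapolation (P.params N M) k S)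
            (accBiOBGStep (P.params N M) f g k S).y
            (hbSol (P.params N M) f g (extrapolation (P.params N M) k S)
              (accBiOBGStep (P.params N M) f g k S).y)
            - gradient (objective f g) (extrapolation (P.params N M) k S)‖ ^ 2
        - P.τ * P.μx / 8 * ‖extrapolation (P.params N M) k S - xs‖ ^ 2 := by
  have hextrapolation : P.τ • (S.x - extrapolation (P.params N M) k S)
      = extrapolation (P.params N M) k S - S.z := by
    have hη : (P.params N M).η k = P.τ / (P.τ + 1) := by
      change √(P.α * P.μx) / (√(P.α * P.μx) + 2) = _
      rw [Constants.τ]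
      field_simp
    have hτ := hP.τ_pos
    rw [extrapolation, hη]
    match_scalars <;> field_simp <;> ring
  have hstep := accelPotential_inexact_step_le (h.isSCSC.quadraticLowerBound_objective hP.μy_pos)
    (h.isSCSC.quadraticUpperBound_objective hP.μy_pos hP.Lxy_nonneg hP.Ly_nonneg hP.Lgxy_nonneg
      hP.ρxy_nonneg hP.ρyy_nonneg h.norm_gradY_le) hP.μx_pos hP.τ_pos hP.τ_le_half
    hP.eight_mul_τ_sq_mul_LΦ_le hxs hextrapolation
    (hypergrad f g (extrapolation (P.params N M) k S) (accBiOBGStep (P.params N M) f g k S).y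
      (hbSol (P.params N M) f g (extrapolation (P.params N M) k S)
        (accBiOBGStep (P.params N M) f g k S).y))
  rwa [← hP.α_eq, ← hP.sqrt_α_div_μx] at hstep

theorem lyapunov_accBiOBGStep_le {xs : E p} (hxs : IsMinOn (objective f g) Set.univ xs) {N : ℕ}
    (hN : P.warmRatio * ((P.κ + 1) * Real.exp (-(N / √P.κ))) ≤ 1) (M k : ℕ) (S : State p q) :
    lyapunov P f g xs (accBiOBGStep (P.params N M) f g k S)
      ≤ (1 - P.τ / 2) * lyapunov P f g xs S + 6 * P.τ / P.μx * P.hbError M ^ 2 := by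
  have hτ := hP.τ_pos
  have hμx := hP.μx_pos
  set xt := extrapolation (P.params N M) k S
  set y' := (accBiOBGStep (P.params N M) f g k S).y
  have hdrift : ‖y' - lowerSol g xs‖ ≤ ‖y' - lowerSol g xt‖ + P.lowerLip * ‖xt - xs‖ :=
    (norm_sub_le_norm_sub_add_norm_sub _ _ _).trans
      (add_le_add_right (h.norm_lowerSol_sub_le hP xt xs) _)
  have hweight : 5 / 2 * (P.warmWeight * P.lowerLip ^ 2) ≤ P.τ * P.μx / 8 := by
    linarith [P.warmWeight_mul, hP.warmWeight_pos]
  have haccuracy : 8 * (3 * P.τ / P.μx * P.hyperLip ^ 2 + P.warmWeight)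
      * ((P.κ + 1) * Real.exp (-(N / √P.κ))) ≤ P.warmWeight := by
    rw [← hP.warmWeight_mul_warmRatio, mul_assoc]
    exact mul_le_of_le_one_right hP.warmWeight_pos.le hN
  have hcoupled := coupled_lyapunov_step (by linarith [hP.τ_le_half]) (by positivity)
    (norm_nonneg _) (norm_nonneg _) hP.warmWeight_pos.le
    (h.accelPotential_accBiOBGStep_le hP hxs N M k S)
    (h.norm_hypergrad_hbSol_sub_gradient_le hP N M xt y') (h.norm_inner_sub_sq_le hP xs xt S.y N)
    hdrift hweight haccuracy
  refine hcoupled.trans (le_of_eq ?_)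
  rw [lyapunov]
  ring

theorem lyapunov_accBiOBG_zero_le {xs : E p} (hxs : IsMinOn (objective f g) Set.univ xs)
    (Q : Params) {Δ r : ℝ} (hΔ : objective f g 0 - objective f g xs ≤ Δ)
    (hr : ‖lowerSol g 0‖ ≤ r) :
    lyapunov P f g xs (accBiOBG Q f g 0) ≤ 2 * Δ + P.μx * r ^ 2 := by
  have hgrowth := h.isSCSC.quadraticLowerBound_objective hP.μy_pos xs 0
  have hgrad : gradient (objective f g) xs = 0 := by
    rw [gradient, (hxs.isLocalMin univ_mem).fderiv_eq_zero, map_zero]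
  rw [hgrad, inner_zero_left, zero_sub, norm_neg] at hgrowth
  have hdist : ‖lowerSol g xs‖ ≤ r + P.lowerLip * ‖xs‖ := by
    have hlip := h.norm_lowerSol_sub_le hP xs 0
    rw [sub_zero] at hlip
    linarith [norm_sub_norm_le (lowerSol g xs) (lowerSol g 0)]
  have hdist_sq : ‖lowerSol g xs‖ ^ 2 ≤ 2 * r ^ 2 + 2 * (P.lowerLip ^ 2 * ‖xs‖ ^ 2) := by
    refine (pow_le_pow_left₀ (norm_nonneg _) hdist 2).trans ?_
    linarith [sq_nonneg (r - P.lowerLip * ‖xs‖)]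
  have hμx := hP.μx_pos
  have hτμ := mul_le_mul_of_nonneg_right hP.τ_le_half hμx.le
  have hA := hP.warmWeight_pos.le
  have hAl : 0 ≤ P.warmWeight * P.lowerLip ^ 2 := by positivity
  have hwarm := mul_le_mul_of_nonneg_left hdist_sq hA
  have hr_sq := mul_le_mul_of_nonneg_right
    (show 40 * P.warmWeight ≤ P.μx by linarith [P.warmWeight_mul]) (sq_nonneg r)
  have hxs_sq := mul_le_mul_of_nonneg_right
    (show 40 * (P.warmWeight * P.lowerLip ^ 2) ≤ P.μx by linarith [P.warmWeight_mul])
    (sq_nonneg ‖xs‖)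
  have hμr : 0 ≤ P.μx * r ^ 2 := by positivity
  have hμxs : 0 ≤ P.μx * ‖xs‖ ^ 2 := by positivity
  simp only [lyapunov, accelPotential, accBiOBG, zero_sub, norm_neg]
  linarith

theorem objective_accBiOBG_sub_le {xs : E p} (hxs : IsMinOn (objective f g) Set.univ xs)
    {Δ r : ℝ} (hΔ : objective f g 0 - objective f g xs ≤ Δ) (hr : ‖lowerSol g 0‖ ≤ r) {N : ℕ}
    (hN : P.warmRatio * ((P.κ + 1) * Real.exp (-(N / √P.κ))) ≤ 1) (M K : ℕ) :
    objective f g (accBiOBG (P.params N M) f g K).z - objective f g xs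
      ≤ Real.exp (-(K * (P.τ / 2))) * (2 * Δ + P.μx * r ^ 2) + 12 / P.μx * P.hbError M ^ 2 := by
  have hμx := hP.μx_pos
  have hτ := hP.τ_le_half
  have hΔ0 : 0 ≤ Δ := (sub_nonneg.2 (hxs (Set.mem_univ 0))).trans hΔ
  set S := accBiOBG (P.params N M) f g
  have hpotential : objective f g (S K).z - objective f g xs ≤ lyapunov P f g xs (S K) := by
    have hA := hP.warmWeight_pos
    have hmomentum : 0 ≤ P.μx / 2 / 2 * ‖(S K).x - xs‖ ^ 2 := by positivity
    have hwarm : 0 ≤ P.warmWeight * ‖(S K).y - lowerSol g xs‖ ^ 2 := by positivity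
    rw [lyapunov, accelPotential]
    linarith
  calc objective f g (S K).z - objective f g xs ≤ lyapunov P f g xs (S K) := hpotential
    _ ≤ (1 - P.τ / 2) ^ K * lyapunov P f g xs (S 0) + 12 / P.μx * P.hbError M ^ 2 :=
      le_pow_mul_add_of_le_mul_add (ρ := 1 - P.τ / 2) (W := fun k => lyapunov P f g xs (S k))
        (w := 12 / P.μx * P.hbError M ^ 2) (by linarith) (by positivity)
        (fun k => (h.lyapunov_accBiOBGStep_le hP hxs hN M k (S k)).trans (le_of_eq (by ring))) K
    _ ≤ (1 - P.τ / 2) ^ K * (2 * Δ + P.μx * r ^ 2) + 12 / P.μx * P.hbError M ^ 2 := by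
      gcongr
      · exact pow_nonneg (by linarith) K
      · exact h.lyapunov_accBiOBG_zero_le hP hxs _ hΔ hr
    _ ≤ _ := by
      gcongr
      exact one_sub_pow_le_exp (by linarith) K

end Constants.InClass

end OuterLoop

section Complexity

theorem exp_neg_ceil_mul_div_le {a : ℝ} (ha : 0 < a) (l : ℝ) :
    Real.exp (-(⌈a * l⌉₊ / a)) ≤ Real.exp (-l) := by
  rw [Real.exp_le_exp, neg_le_neg_iff, le_div_iff₀ ha, mul_comm]
  exact Nat.le_ceil _

theorem half_le_log_div {P ε : ℝ} (hε : 0 < ε) (hP : 2 * ε ≤ P) : 1 / 2 ≤ Real.log (P / ε) := by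
  have hlog := Real.log_le_log two_pos ((le_div_iff₀ hε).2 hP)
  linarith [Real.log_two_gt_d9]

theorem monotoneOn_smoothPhi_mul_pow {Lx Lxy Ly Lgxy ρxy ρyy U : ℝ} (hLx : 0 ≤ Lx)
    (hLxy : 0 ≤ Lxy) (hLy : 0 ≤ Ly) (hLgxy : 0 ≤ Lgxy) (hρxy : 0 ≤ ρxy) (hρyy : 0 ≤ ρyy)
    (hU : 0 ≤ U) :
    MonotoneOn (fun μ => smoothPhi Lx Lxy Ly Lgxy ρxy ρyy U μ * μ ^ 3) (Set.Ioi 0) := by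
  have hexpand : Set.EqOn
      (fun μ => Lx * μ ^ 3 + 2 * Lxy * Lgxy * μ ^ 2
        + (U * ρxy * μ + U * Lgxy * ρyy) * (μ + Lgxy) + Lgxy ^ 2 * Ly * μ)
      (fun μ => smoothPhi Lx Lxy Ly Lgxy ρxy ρyy U μ * μ ^ 3) (Set.Ioi 0) := by
    intro μ (hμ : 0 < μ)
    simp only [smoothPhi]
    field_simp
  refine MonotoneOn.congr (fun μ (hμ : 0 < μ) ν (hν : 0 < ν) hμν => ?_) hexpand
  gcongr

theorem accBiOBG_complexity {p q : ℕ} (t : ℝ) (Q : Params) (f g : E p → E q → ℝ) (K : ℕ) :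
    (accBiOBG Q f g K).complexity t = K * (t * (1 + (Q.M - 1 : ℕ)) + Q.N + 2) := by
  have hcounters : (accBiOBG Q f g K).nG = K * (Q.N + 2) ∧ (accBiOBG Q f g K).nJ = K ∧
      (accBiOBG Q f g K).nH = K * (Q.M - 1) := by
    induction K with
    | zero => simp [accBiOBG]
    | succ k ih =>
      obtain ⟨hG, hJ, hH⟩ := ih
      simp only [accBiOBG, accBiOBGStep, iterate_agdStep_nG, iterate_hbStep_nH, hG, hJ, hH,
        zero_add]
      refine ⟨?_, trivial, ?_⟩ <;> ring
  obtain ⟨hG, hJ, hH⟩ := hcounters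
  rw [State.complexity, hG, hJ, hH]
  push_cast
  ring

namespace Constants

variable (P : Constants)

/-- The length `N` of the accelerated gradient loop that gains the factor `exp (-l)`. -/
def agdLength (l : ℝ) : ℕ := ⌈√P.κ * l⌉₊

/-- The length `M` of the heavy-ball loop that gains the factor `exp (-l)`; the last summand
accounts for the initial value `v⁰ = v¹ = 0`. -/
def hbLength (l : ℝ) : ℕ := ⌈(√P.κ + 1) * l⌉₊ + 1

/-- The number `K` of outer iterations that gains the factor `exp (-l)`. -/
def outerLength (l : ℝ) : ℕ := ⌈2 / P.τ * l⌉₊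

/-- The value of the polynomial `P₂` in the logarithmic factor of the two inner loops. -/
def innerBound (D : ℝ) : ℝ :=
  2 * D + D * (P.warmRatio * (P.κ + 1)) + 192 * P.Lgxy ^ 2 * (P.κ + 1) * P.U ^ 2 / (P.μx * P.μy ^ 2)

/-- The value of the polynomial `P₁` in the logarithmic factor of the outer loop. -/
def outerBound (D Δ r : ℝ) : ℝ := 2 * D + 2 * (2 * Δ + P.μx * r ^ 2)

variable {P}

theorem IsAdmissible.of_stepsize {c : ℝ} (hc : 0 < c) (hLxy : 0 ≤ P.Lxy) (hLy : 0 ≤ P.Ly)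
    (hLgxy : 0 ≤ P.Lgxy) (hρxy : 0 ≤ P.ρxy) (hρyy : 0 ≤ P.ρyy) (hU : 0 ≤ P.U) (hμx : 0 < P.μx)
    (hμy : 0 < P.μy) (hμy_le : P.μy ≤ P.Lgy) (hμx_le : P.μx ≤ P.LΦ) (hcα : c / P.LΦ ≤ P.α)
    (hα : P.α ≤ 1 / (2 * P.LΦ)) : P.IsAdmissible where
  Lxy_nonneg := hLxy
  Ly_nonneg := hLy
  Lgxy_nonneg := hLgxy
  ρxy_nonneg := hρxy
  ρyy_nonneg := hρyy
  U_nonneg := hU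
  μx_pos := hμx
  μy_pos := hμy
  μy_le_Lgy := hμy_le
  μx_le_LΦ := hμx_le
  α_pos := (div_pos hc (hμx.trans_le hμx_le)).trans_le hcα
  α_mul_LΦ_le := by
    rw [← div_div] at hα
    exact (le_div_iff₀ (hμx.trans_le hμx_le)).1 hα

theorem two_mul_le_outerBound (hμx : 0 ≤ P.μx) {ε D Δ : ℝ} (hεD : ε ≤ D) (hΔ : 0 ≤ Δ) (r : ℝ) :
    2 * ε ≤ P.outerBound D Δ r := by
  have hr : 0 ≤ P.μx * r ^ 2 := by positivity
  rw [outerBound]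
  linarith

namespace IsAdmissible

variable (hP : P.IsAdmissible)
include hP

theorem le_innerBound {D : ℝ} (hD : 0 ≤ D) :
    2 * D ≤ P.innerBound D ∧ D * (P.warmRatio * (P.κ + 1)) ≤ P.innerBound D ∧
      192 * P.Lgxy ^ 2 * (P.κ + 1) * P.U ^ 2 / (P.μx * P.μy ^ 2) ≤ P.innerBound D := by
  have hκ := hP.one_le_κ
  have hμx := hP.μx_pos
  have hagd : 0 ≤ D * (P.warmRatio * (P.κ + 1)) := by
    rw [warmRatio]
    positivity
  have hhb : 0 ≤ 192 * P.Lgxy ^ 2 * (P.κ + 1) * P.U ^ 2 / (P.μx * P.μy ^ 2) := by positivity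
  rw [innerBound]
  refine ⟨?_, ?_, ?_⟩ <;> linarith

theorem two_mul_le_innerBound {ε D : ℝ} (hε : 0 ≤ ε) (hεD : ε ≤ D) : 2 * ε ≤ P.innerBound D := by
  linarith [(hP.le_innerBound (hε.trans hεD)).1]

theorem hbError_sq_le (l : ℝ) :
    P.hbError (P.hbLength l) ^ 2
      ≤ 8 * P.Lgxy ^ 2 * (P.κ + 1) * P.U ^ 2 / P.μy ^ 2 * Real.exp (-l) ^ 2 := by
  have hκ := hP.one_le_κ
  have hsqrt : (√P.κ + 1) ^ 2 ≤ 2 * (P.κ + 1) := by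
    have hsq := add_sq_le (a := √P.κ) (b := 1)
    rwa [Real.sq_sqrt (by linarith), one_pow] at hsq
  have hexp := exp_neg_ceil_mul_div_le (a := √P.κ + 1) (by positivity) l
  rw [hbError, hbLength, Nat.add_sub_cancel]
  calc _ = 4 * P.Lgxy ^ 2 * P.U ^ 2 / P.μy ^ 2 * (√P.κ + 1) ^ 2
          * Real.exp (-(⌈(√P.κ + 1) * l⌉₊ / (√P.κ + 1))) ^ 2 := by ring
    _ ≤ 4 * P.Lgxy ^ 2 * P.U ^ 2 / P.μy ^ 2 * (2 * (P.κ + 1)) * Real.exp (-l) ^ 2 := by gcongr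
    _ = _ := by ring

theorem hbError_sq_le_half {ε D : ℝ} (hε : 0 < ε) (hεD : ε ≤ D) :
    12 / P.μx * P.hbError (P.hbLength (Real.log (P.innerBound D / ε))) ^ 2 ≤ ε / 2 := by
  have hμx := hP.μx_pos
  obtain ⟨hDB, -, hhb⟩ := hP.le_innerBound (hε.le.trans hεD)
  set B := P.innerBound D
  have hB : 0 < B := by linarith
  have hratio : ε / B ≤ 1 := (div_le_one hB).2 (by linarith)
  have herror := hP.hbError_sq_le (Real.log (B / ε))
  rw [Real.exp_neg, Real.exp_log (div_pos hB hε), inv_div] at herror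
  calc 12 / P.μx * P.hbError (P.hbLength (Real.log (B / ε))) ^ 2
      ≤ 12 / P.μx * (8 * P.Lgxy ^ 2 * (P.κ + 1) * P.U ^ 2 / P.μy ^ 2 * (ε / B) ^ 2) := by gcongr
    _ = 192 * P.Lgxy ^ 2 * (P.κ + 1) * P.U ^ 2 / (P.μx * P.μy ^ 2) * (ε / B) ^ 2 / 2 := by ring
    _ ≤ B * (ε / B) / 2 := by
      gcongr
      exact pow_le_of_le_one (by positivity) hratio two_ne_zero
    _ = ε / 2 := by rw [mul_div_cancel₀ _ hB.ne']

theorem warmRatio_mul_agdLength_le_one {ε D : ℝ} (hε : 0 < ε) (hεD : ε ≤ D) :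
    P.warmRatio * ((P.κ + 1) * Real.exp (-(P.agdLength (Real.log (P.innerBound D / ε)) / √P.κ)))
      ≤ 1 := by
  have hκ := hP.one_le_κ
  obtain ⟨hDB, hwarm, -⟩ := hP.le_innerBound (hε.le.trans hεD)
  set B := P.innerBound D
  have hB : 0 < B := by linarith
  have hexp := exp_neg_ceil_mul_div_le (a := √P.κ) (by positivity) (Real.log (B / ε))
  rw [Real.exp_neg (Real.log _), Real.exp_log (div_pos hB hε), inv_div] at hexp
  have hwarm_pos : 0 ≤ P.warmRatio * (P.κ + 1) := by
    rw [warmRatio]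
    positivity
  rw [agdLength, ← mul_assoc]
  calc _ ≤ P.warmRatio * (P.κ + 1) * (ε / B) := by gcongr
    _ = ε * (P.warmRatio * (P.κ + 1)) / B := by ring
    _ ≤ D * (P.warmRatio * (P.κ + 1)) / B := by gcongr
    _ ≤ 1 := (div_le_one hB).2 hwarm

theorem sqrt_κ_div_τ_le {c B : ℝ} (hc : 0 < c) (hcα : c / P.LΦ ≤ P.α)
    (hB : P.LΦ * P.μy ^ 3 ≤ B) :
    √P.κ / P.τ ≤ 2 * √(B / c) * √(P.Lgy / (P.μx * P.μy ^ 4)) := by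
  have hμx := hP.μx_pos
  have hμy := hP.μy_pos
  have hLgy := hμy.trans_le hP.μy_le_Lgy
  have hα := hP.α_pos
  have hc_le := (div_le_iff₀ (hμx.trans_le hP.μx_le_LΦ)).1 hcα
  have hscaled : c * P.μy ^ 3 ≤ P.α * B :=
    calc c * P.μy ^ 3 ≤ P.α * P.LΦ * P.μy ^ 3 := by gcongr
      _ ≤ P.α * B := by
        rw [mul_assoc]
        gcongr
  have hstep : P.μy ^ 3 / P.α ≤ B / c := by
    rw [div_le_div_iff₀ hα hc]
    linarith
  have hsqrt : √P.κ / √(P.α * P.μx) ≤ √(B / c) * √(P.Lgy / (P.μx * P.μy ^ 4)) := by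
    rw [κ, ← Real.sqrt_div (by positivity), ← Real.sqrt_mul (le_trans (by positivity) hstep)]
    apply Real.sqrt_le_sqrt
    calc P.Lgy / P.μy / (P.α * P.μx)
        = P.μy ^ 3 / P.α * (P.Lgy / (P.μx * P.μy ^ 4)) := by field_simp
      _ ≤ _ := by gcongr
  calc √P.κ / P.τ = 2 * (√P.κ / √(P.α * P.μx)) := by
        rw [τ]
        field_simp
    _ ≤ 2 * (√(B / c) * √(P.Lgy / (P.μx * P.μy ^ 4))) := by gcongr
    _ = _ := by ring

theorem outerLength_mul_le {t l₁ l₂ : ℝ} (ht : 0 ≤ t) (hl₁ : 1 / 2 ≤ l₁) (hl₂ : 1 / 2 ≤ l₂) :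
    P.outerLength l₁ * (t * (1 + (P.hbLength l₂ - 1 : ℕ)) + P.agdLength l₂ + 2)
      ≤ 3 * (6 * t + 7) * (√P.κ / P.τ) * l₁ * l₂ := by
  have hτ := hP.τ_pos
  have hτ_le := hP.τ_le_half
  have hκ : 1 ≤ √P.κ := Real.one_le_sqrt.2 hP.one_le_κ
  have hκl : l₂ ≤ √P.κ * l₂ := le_mul_of_one_le_left (by linarith) hκ
  have hτl : 1 ≤ 1 / P.τ * l₁ := by
    rw [one_div_mul_eq_div, one_le_div hτ]
    linarith
  have hK : (P.outerLength l₁ : ℝ) ≤ 3 / P.τ * l₁ := by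
    refine (Nat.ceil_lt_add_one (by positivity)).le.trans ?_
    linear_combination hτl
  have hN : (P.agdLength l₂ : ℝ) ≤ √P.κ * l₂ + 1 := (Nat.ceil_lt_add_one (by positivity)).le
  have hM : ((P.hbLength l₂ - 1 : ℕ) : ℝ) ≤ (√P.κ + 1) * l₂ + 1 := by
    rw [hbLength, Nat.add_sub_cancel]
    exact (Nat.ceil_lt_add_one (by positivity)).le
  have hhb : t * (1 + (P.hbLength l₂ - 1 : ℕ)) ≤ t * (6 * (√P.κ * l₂)) :=
    mul_le_mul_of_nonneg_left (by linarith) ht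
  have hcalls : t * (1 + (P.hbLength l₂ - 1 : ℕ)) + P.agdLength l₂ + 2
      ≤ (6 * t + 7) * (√P.κ * l₂) := by linarith
  calc _ ≤ 3 / P.τ * l₁ * ((6 * t + 7) * (√P.κ * l₂)) := by gcongr
    _ = _ := by ring

end IsAdmissible

theorem InClass.objective_accBiOBG_sub_le_eps {p q : ℕ} {f g : E p → E q → ℝ} (h : P.InClass f g)
    (hP : P.IsAdmissible) {xs : E p} (hxs : IsMinOn (objective f g) Set.univ xs) {Δ r : ℝ}
    (hΔ : objective f g 0 - objective f g xs ≤ Δ) (hr : ‖lowerSol g 0‖ ≤ r) {ε D : ℝ}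
    (hε : 0 < ε) (hεD : ε ≤ D) :
    objective f g (accBiOBG
        (P.params (P.agdLength (Real.log (P.innerBound D / ε)))
          (P.hbLength (Real.log (P.innerBound D / ε))))
        f g (P.outerLength (Real.log (P.outerBound D Δ r / ε)))).z
      - objective f g xs ≤ ε := by
  have hμx := hP.μx_pos
  have hτ := hP.τ_pos
  have hΔ0 : 0 ≤ Δ := (sub_nonneg.2 (hxs (Set.mem_univ 0))).trans hΔ
  have hB := two_mul_le_outerBound hμx.le hεD hΔ0 r
  have hinit : 2 * Δ + P.μx * r ^ 2 ≤ P.outerBound D Δ r / 2 := by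
    rw [outerBound]
    linarith
  set B := P.outerBound D Δ r
  have hBpos : 0 < B := by linarith
  have hexp := exp_neg_ceil_mul_div_le (a := 2 / P.τ) (by positivity) (Real.log (B / ε))
  rw [Real.exp_neg (Real.log _), Real.exp_log (div_pos hBpos hε), inv_div, div_div_eq_mul_div,
    mul_div_assoc] at hexp
  refine (h.objective_accBiOBG_sub_le hP hxs hΔ hr (hP.warmRatio_mul_agdLength_le_one hε hεD)
    _ _).trans ?_
  calc _ ≤ ε / B * (B / 2) + ε / 2 :=
        add_le_add (mul_le_mul hexp hinit (by positivity) (by positivity))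
          (hP.hbError_sq_le_half hε hεD)
    _ = ε := by
      field_simp
      ring

theorem IsAdmissible.accBiOBG_complexity_le (hP : P.IsAdmissible) {p q : ℕ}
    (f g : E p → E q → ℝ) {t c B C l₁ l₂ : ℝ} (ht : 0 ≤ t) (hc : 0 < c) (hcα : c / P.LΦ ≤ P.α)
    (hB : P.LΦ * P.μy ^ 3 ≤ B) (hC : 6 * (6 * t + 7) * √(B / c) ≤ C) (hl₁ : 1 / 2 ≤ l₁)
    (hl₂ : 1 / 2 ≤ l₂) :
    (accBiOBG (P.params (P.agdLength l₂) (P.hbLength l₂)) f g (P.outerLength l₁)).complexity t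
      ≤ C * √(P.Lgy / (P.μx * P.μy ^ 4)) * l₁ * l₂ := by
  have : 0 < l₁ := by linarith
  have : 0 < l₂ := by linarith
  rw [accBiOBG_complexity]
  calc _ ≤ 3 * (6 * t + 7) * (√P.κ / P.τ) * l₁ * l₂ := hP.outerLength_mul_le ht hl₁ hl₂
    _ ≤ 3 * (6 * t + 7) * (2 * √(B / c) * √(P.Lgy / (P.μx * P.μy ^ 4))) * l₁ * l₂ := by
      gcongr
      exact hP.sqrt_κ_div_τ_le hc hcα hB
    _ = 6 * (6 * t + 7) * √(B / c) * √(P.Lgy / (P.μx * P.μy ^ 4)) * l₁ * l₂ := by ring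
    _ ≤ _ := by gcongr

end Constants

open MvPolynomial in
/-- The polynomial `P₁` of the theorem, in the variables `μₓ, μₓ⁻¹, μ_y, μ_y⁻¹, L̃_y, U, Δ, r`. -/
def outerPolynomial (D : ℝ) : MvPolynomial (Fin 8) ℝ :=
  C (2 * D) + C 2 * (C 2 * X 6 + X 0 * X 7 ^ 2)

open MvPolynomial in
/-- The polynomial `P₂` of the theorem, in the variables `μₓ, μₓ⁻¹, μ_y, μ_y⁻¹, L̃_y, U`. -/
def innerPolynomial (Lxy Ly Lgxy ρxy ρyy D : ℝ) : MvPolynomial (Fin 6) ℝ :=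
  let hyperLip := C Lxy + C (Lgxy * Ly) * X 3 + (C ρxy * X 5 * X 3 + C (Lgxy * ρyy) * X 5 * X 3 ^ 2)
  C (2 * D)
    + C (8 * D) * (C 60 * hyperLip ^ 2 * (1 + C (Lgxy ^ 2) * X 3 ^ 2) * X 1 ^ 2 + 1)
      * (X 4 * X 3 + 1)
    + C (192 * Lgxy ^ 2) * (X 4 * X 3 + 1) * X 5 ^ 2 * X 1 * X 3 ^ 2

theorem Constants.eval_outerPolynomial (P : Constants) (D Δ r : ℝ) :
    MvPolynomial.eval ![P.μx, P.μx⁻¹, P.μy, P.μy⁻¹, P.Lgy, P.U, Δ, r] (outerPolynomial D)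
      = P.outerBound D Δ r := by
  simp [outerPolynomial, outerBound]

theorem Constants.eval_innerPolynomial (P : Constants) (D : ℝ) :
    MvPolynomial.eval ![P.μx, P.μx⁻¹, P.μy, P.μy⁻¹, P.Lgy, P.U]
        (innerPolynomial P.Lxy P.Ly P.Lgxy P.ρxy P.ρyy D) = P.innerBound D := by
  simp [innerPolynomial, innerBound, warmRatio, hyperLip, lowerLip, κ]
  ring

end Complexity

end Bilevel

end

theorem mainTheorem5
    -- the constants of the problem class that the `O(·)` may depend on
    (Lx Lxy Ly Lgxy ρxy ρyy : ℝ)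
    (hLx : 0 ≤ Lx) (hLxy : 0 ≤ Lxy) (hLy : 0 ≤ Ly) (hLgxy : 0 ≤ Lgxy)
    (hρxy : 0 ≤ ρxy) (hρyy : 0 ≤ ρyy)
    -- `t`: cost of a Jacobian- or Hessian-vector product; `c`: the stepsize is at least `c / L_Φ`;
    -- `D`: any a priori upper bound for `μ_y` and `ε`
    (t : ℝ) (ht : 0 < t) (c : ℝ) (hc : 0 < c) (D : ℝ) (hD : 0 < D) :
    ∃ (P₁ : MvPolynomial (Fin 8) ℝ) (P₂ : MvPolynomial (Fin 6) ℝ),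
    ∀ U : ℝ, 0 ≤ U → ∃ C : ℝ, 0 < C ∧
    ∀ Lgy μx μy ε α : ℝ, 0 < μx → 0 < μy → μy ≤ D → 0 < ε → ε ≤ D →
      c / Bilevel.smoothPhi Lx Lxy Ly Lgxy ρxy ρyy U μy ≤ α →
      α ≤ 1 / (2 * Bilevel.smoothPhi Lx Lxy Ly Lgxy ρxy ρyy U μy) →
    ∃ N M : ℕ, ∀ Δ r : ℝ, ∃ K : ℕ,
    ∀ (p q : ℕ) (f g : Bilevel.E p → Bilevel.E q → ℝ) (xs : Bilevel.E p), 1 ≤ q →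
      Bilevel.IsSCSC Lx Lxy Ly Lgxy Lgy ρxy ρyy μx μy f g →
      (∀ x y, ‖Bilevel.gradY f x y‖ ≤ U) →
      IsMinOn (Bilevel.objective f g) Set.univ xs →
      Bilevel.objective f g 0 - Bilevel.objective f g xs ≤ Δ →
      ‖Bilevel.lowerSol g 0‖ ≤ r →
      -- `Φ` is differentiable and `L_Φ`-smooth
      (Differentiable ℝ (Bilevel.objective f g) ∧
        ∀ x₁ x₂, ‖gradient (Bilevel.objective f g) x₁ - gradient (Bilevel.objective f g) x₂‖
          ≤ Bilevel.smoothPhi Lx Lxy Ly Lgxy ρxy ρyy U μy * ‖x₁ - x₂‖) ∧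
      -- the output is `ε`-optimal
      Bilevel.objective f g
          (Bilevel.accBiOBG (Bilevel.scscParams Lgy μx μy α N M) f g K).z
        - Bilevel.objective f g xs ≤ ε ∧
      -- both logarithms below are positive
      ε < MvPolynomial.eval ![μx, μx⁻¹, μy, μy⁻¹, Lgy, U, Δ, r] P₁ ∧
      ε < MvPolynomial.eval ![μx, μx⁻¹, μy, μy⁻¹, Lgy, U] P₂ ∧
      -- and it is reached within the claimed complexity
      (Bilevel.accBiOBG (Bilevel.scscParams Lgy μx μy α N M) f g K).complexity t
        ≤ C * √(Lgy / (μx * μy ^ 4))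
          * Real.log (MvPolynomial.eval ![μx, μx⁻¹, μy, μy⁻¹, Lgy, U, Δ, r] P₁ / ε)
          * Real.log (MvPolynomial.eval ![μx, μx⁻¹, μy, μy⁻¹, Lgy, U] P₂ / ε) := by
  refine ⟨Bilevel.outerPolynomial D, Bilevel.innerPolynomial Lxy Ly Lgxy ρxy ρyy D, fun U hU =>
    ⟨6 * (6 * t + 7) * √(Bilevel.smoothPhi Lx Lxy Ly Lgxy ρxy ρyy U D * D ^ 3 / c) + 1,
      by positivity, fun Lgy μx μy ε α hμx hμy hμyD hε hεD hcα hα => ?_⟩⟩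
  let P : Bilevel.Constants := ⟨Lx, Lxy, Ly, Lgxy, Lgy, ρxy, ρyy, μx, μy, U, α⟩
  by_cases hclass : μy ≤ Lgy ∧ μx ≤ P.LΦ
  swap
  · exact ⟨0, 0, fun _ _ => ⟨0, fun p q f g xs hq h hfU => absurd
      ⟨h.μy_le_Lgy hq, h.μx_le_smoothPhi hμy hLxy hLy hLgxy hρxy hρyy hfU⟩ hclass⟩⟩
  have hP : P.IsAdmissible :=
    .of_stepsize hc hLxy hLy hLgxy hρxy hρyy hU hμx hμy hclass.1 hclass.2 hcα hα
  have hLΦ := Bilevel.monotoneOn_smoothPhi_mul_pow hLx hLxy hLy hLgxy hρxy hρyy hU hμy hD hμyD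
  refine ⟨P.agdLength (Real.log (P.innerBound D / ε)), P.hbLength (Real.log (P.innerBound D / ε)),
    fun Δ r => ⟨P.outerLength (Real.log (P.outerBound D Δ r / ε)), ?_⟩⟩
  intro p q f g xs _ hfg hfU hxs hΔ hr
  have h : P.InClass f g := ⟨hfg, hfU⟩
  have hB₁ := P.two_mul_le_outerBound hμx.le hεD ((sub_nonneg.2 (hxs (Set.mem_univ 0))).trans hΔ) r
  have hB₂ := hP.two_mul_le_innerBound hε.le hεD
  rw [show MvPolynomial.eval _ _ = _ from P.eval_outerPolynomial D Δ r,
    show MvPolynomial.eval _ _ = _ from P.eval_innerPolynomial D]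
  refine ⟨⟨hfg.differentiable_objective hμy, h.norm_gradient_objective_sub_le hP⟩,
    h.objective_accBiOBG_sub_le_eps hP hxs hΔ hr hε hεD, by linarith, by linarith, ?_⟩
  exact hP.accBiOBG_complexity_le f g ht.le hc hcα hLΦ (le_add_of_nonneg_right zero_le_one)
    (Bilevel.half_le_log_div hε hB₁) (Bilevel.half_le_log_div hε hB₂)
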